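/- A stable matching instance consists of $n\ge 0$ men and $n$ women; every man has a preference list, i.e. a strict total order, of the $n$ women, and every woman has one of the $n$ men. A matching (a bijection between the men and the women) is stable if there are no man $M$ and woman $w$ who both strictly prefer each other to their partners. The instance is in the $1$-attribute model if every man $M_i$ has a preference value $\hat M_i\in\mathbb R$ and a position value $\bar M_i\in\mathbb R$, every woman $w_j$ has values $\hat w_j,\bar w_j\in\mathbb R$, and $M_i$ prefers $w_j$ over $w_\ell$ if and only if $\hat M_i\bar w_j>\hat M_i\bar w_\ell$, and $w_j$ prefers $M_i$ over $M_h$ if and only if $\hat w_j\bar M_i>\hat w_j\bar M_h$. For a stable matching $\mathcal M$, the suitor of a man $M$ is the first woman $w$ on his list (if any) such that $M$ prefers his spouse over $w$ and $w$ prefers $M$ over her spouse. A rotation is a cyclically ordered non-empty list of distinct pairs $(M_0,w_0),\dots,(M_{k-1},w_{k-1})$ of some stable matching $\mathcal M$ such that, for all $i$, the suitor of $M_i$ in $\mathcal M$ is $w_{i+1 \bmod k}$; it moves $M_i$ from $w_i$ to $w_{i+1 \bmod k}$. A rotation $R$ eliminates the pair $(M,w)$ if it moves $w$ from $M$, or from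 a man below $M$ on her list, to a man strictly above $M$. A rotation $R$ explicitly precedes a rotation $R'\ne R$ if $R$ eliminates some pair $(M,w)$ and $R'$ moves $M$ to a woman $w'$ such that $M$ strictly prefers $w$ to $w'$. The rotation poset is the set of all rotations, ordered by the transitive closure of this relation. **Theorem.** There is a polynomial-time algorithm that, given the $2n$ preference lists of an instance in the $1$-attribute model, computes the exact number of its stable matchings. Moreover, for every such instance the rotation poset is a path (a finite chain), and the number of stable matchings equals the number of downsets of the rotation poset, which is the number of rotations plus one. -/

import Mathlib

/-! ### Stable matching instances -/

/-- A stable matching instance with `n` men and `n` women, both numbered by `Fin n`.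
`men i r` is the woman in position `r` of the preference list of man `i` (position `0` is his
favourite), and `women j r` is the man in position `r` of the preference list of woman `j`. -/
structure SMInstance (n : ℕ) where
  men : Fin n → Equiv.Perm (Fin n)
  women : Fin n → Equiv.Perm (Fin n)

namespace SMInstance

variable {n : ℕ}

/-- Man `i` (strictly) prefers woman `j` over woman `l`. -/
def ManPrefers (I : SMInstance n) (i j l : Fin n) : Prop :=
  (I.men i).symm j < (I.men i).symm l

/-- Woman `j` (strictly) prefers man `i` over man `h`. -/
def WomanPrefers (I : SMInstance n) (j i h : Fin n) : Prop :=
  (I.women j).symm i < (I.women j).symm h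

/-- A matching `μ` sends each man to his wife. It is stable if it has no blocking pair. -/
def IsStable (I : SMInstance n) (μ : Equiv.Perm (Fin n)) : Prop :=
  ∀ i j : Fin n, ¬ (I.ManPrefers i j (μ i) ∧ I.WomanPrefers j i (μ.symm j))

/-- The number of stable matchings. -/
noncomputable def numStable (I : SMInstance n) : ℕ :=
  Nat.card {μ : Equiv.Perm (Fin n) // I.IsStable μ}

open scoped Matrix in
/-- The `k`-attribute setting: every person has a preference vector and a position vector
in `ℝ^k`, and the preference lists are determined by the dot products. -/
def IsAttribute (k : ℕ) (I : SMInstance n) : Prop :=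
  ∃ manPref manPos womanPref womanPos : Fin n → (Fin k → ℝ),
    (∀ i j l : Fin n,
      I.ManPrefers i j l ↔ manPref i ⬝ᵥ womanPos j > manPref i ⬝ᵥ womanPos l) ∧
    (∀ j i h : Fin n,
      I.WomanPrefers j i h ↔ womanPref j ⬝ᵥ manPos i > womanPref j ⬝ᵥ manPos h)

/-! ### Rotations and the rotation poset -/

/-- Man `i` prefers his wife in `μ` over `w`, and `w` prefers `i` over her husband in `μ`. -/
def SuitorCandidate (I : SMInstance n) (μ : Equiv.Perm (Fin n)) (i w : Fin n) : Prop :=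
  I.ManPrefers i (μ i) w ∧ I.WomanPrefers w i (μ.symm w)

/-- `w` is the suitor of man `i` in `μ`: the first candidate on his list. -/
def IsSuitor (I : SMInstance n) (μ : Equiv.Perm (Fin n)) (i w : Fin n) : Prop :=
  I.SuitorCandidate μ i w ∧ ∀ w', I.SuitorCandidate μ i w' → w' = w ∨ I.ManPrefers i w w'

/-- `R = {(M₀,w₀), …, (M_{k-1},w_{k-1})}` (man first), a cyclically ordered nonempty list of
distinct pairs of `μ`, is exposed in `μ`: the suitor of `M_i` is `w_{i+1 mod k}`. -/
def Exposed (I : SMInstance n) (μ : Equiv.Perm (Fin n)) (R : Cycle (Fin n × Fin n)) : Prop :=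
  R ≠ Cycle.nil ∧ R.Nodup ∧ (∀ p ∈ R, μ p.1 = p.2) ∧
    R.Chain (fun p q => I.IsSuitor μ p.1 q.2)

/-- The rotations of the instance: the cyclic lists that are exposed in some stable matching. -/
def Rotation (I : SMInstance n) : Type :=
  {R : Cycle (Fin n × Fin n) // ∃ μ, I.IsStable μ ∧ I.Exposed μ R}

/-- `q` directly follows `p` in the cyclic list `R` (of length at least two, which is the case for
every rotation). So `R` moves man `p.1` from `p.2` to `q.2`, and woman `q.2` from `q.1` to `p.1`. -/
def Follows (R : Cycle (Fin n × Fin n)) (p q : Fin n × Fin n) : Prop :=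
  ∃ l : List (Fin n × Fin n), R = ((p :: q :: l : List (Fin n × Fin n)) : Cycle (Fin n × Fin n))

/-- The pair `(M, w)` is eliminated by `R`: `R` moves `w` from `M` or below on her list to a man
strictly above `M`. -/
def Eliminates (I : SMInstance n) (R : Cycle (Fin n × Fin n)) (M w : Fin n) : Prop :=
  ∃ p q, Follows R p q ∧ q.2 = w ∧ (q.1 = M ∨ I.WomanPrefers w M q.1) ∧ I.WomanPrefers w p.1 M

/-- `R` explicitly precedes `R'`: `R` eliminates a pair `(M, w)` and `R'` moves `M` to a woman
to whom `M` strictly prefers `w`. -/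
def ExplicitlyPrecedes (I : SMInstance n) (R R' : I.Rotation) : Prop :=
  R ≠ R' ∧ ∃ M w, I.Eliminates R.1 M w ∧
    ∃ p q, Follows R'.1 p q ∧ p.1 = M ∧ I.ManPrefers M w q.2

/-- The (strict) order of the rotation poset. -/
def Precedes (I : SMInstance n) : I.Rotation → I.Rotation → Prop :=
  Relation.TransGen I.ExplicitlyPrecedes

/-- The downsets of the rotation poset. -/
def RotationDownset (I : SMInstance n) : Type :=
  {D : Set I.Rotation // ∀ R ∈ D, ∀ R', I.Precedes R' R → R' ∈ D}

/-- An instance as an input: `n`, then the `n` preference lists of the men, then the `n`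
preference lists of the women, each list being written from the favourite downwards. -/
def encode (I : SMInstance n) : List ℕ :=
  n :: ((List.ofFn fun i => List.ofFn fun r => (I.men i r : ℕ)).flatten ++
    (List.ofFn fun j => List.ofFn fun r => (I.women j r : ℕ)).flatten)

end SMInstance

/-- The instances of the problem of counting the stable matchings in the `k`-attribute setting. -/
def AttributeInstance (k : ℕ) : Type :=
  Σ n : ℕ, {I : SMInstance n // I.IsAttribute k}

/-! ### Random access machines and polynomial time

The machine is the random access machine of Cook and Reckhow. Registers hold natural numbers and
every instruction costs one step. There is no multiplication, so that a step at most doubles the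
largest register content, and the number of steps is polynomially related to the running time of
Turing machines. -/

namespace RAM

/-- The instructions; `X i` is the content of register `i`. -/
inductive Instr : Type
  /-- `X i ← c` -/
  | const (i c : ℕ)
  /-- `X i ← X j + X k` -/
  | add (i j k : ℕ)
  /-- `X i ← X j - X k` (or `0` if `X j < X k`) -/
  | sub (i j k : ℕ)
  /-- `X i ← X (X j)` -/
  | load (i j : ℕ)
  /-- `X (X i) ← X j` -/
  | store (i j : ℕ)
  /-- continue with instruction number `m` if `X j > 0` -/
  | jump (m j : ℕ)
  /-- remove the next number from the input and put it into `X i` (`0` at the end of the input) -/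
  | read (i : ℕ)

/-- A configuration: the number of the next instruction, the registers, and the unread input. -/
structure Config : Type where
  pc : ℕ
  reg : ℕ → ℕ
  input : List ℕ

/-- Put `v` into register `i` and go on to the next instruction. -/
def Config.write (c : Config) (i v : ℕ) : Config :=
  { c with pc := c.pc + 1, reg := Function.update c.reg i v }

/-- The effect of an instruction. -/
def Instr.exec (c : Config) : Instr → Config
  | .const i a => c.write i a
  | .add i j k => c.write i (c.reg j + c.reg k)
  | .sub i j k => c.write i (c.reg j - c.reg k)
  | .load i j => c.write i (c.reg (c.reg j))
  | .store i j => c.write (c.reg i) (c.reg j)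
  | .jump m j => { c with pc := if 0 < c.reg j then m else c.pc + 1 }
  | .read i => { c.write i (c.input.headD 0) with input := c.input.tail }

/-- One step of the program `P`, a finite list of instructions. The machine has halted when there
is no instruction with the current number. -/
def step (P : List Instr) (c : Config) : Config :=
  match P[c.pc]? with
  | some a => a.exec c
  | none => c

/-- The initial configuration on input `x`. -/
def start (x : List ℕ) : Config := ⟨0, fun _ => 0, x⟩

/-- On input `x` the program `P` halts after at most `T` steps with output `y` in register `0`. -/
def Outputs (P : List Instr) (x : List ℕ) (y T : ℕ) : Prop :=
  ∃ t ≤ T, P.length ≤ ((step P)^[t] (start x)).pc ∧ ((step P)^[t] (start x)).reg 0 = y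

/-- The length of an input: the number of bits of its entries, and one separator for each. -/
def inputLength (x : List ℕ) : ℕ := (x.map fun a => a.size + 1).sum

/-- The function `f` of inputs encoded by `enc` is computable in time polynomial in the length of
the input. -/
def PolyTime {α : Type} (enc : α → List ℕ) (f : α → ℕ) : Prop :=
  ∃ (P : List Instr) (p : Polynomial ℕ),
    ∀ a : α, Outputs P (enc a) (f a) (p.eval (inputLength (enc a)))

end RAM

/-! With one attribute only the sign of a preference value matters: every man ranks the women by one
common order `τ` or by its reverse, and every woman ranks the men by a common `σ` or its reverse
(`IsAttribute.aligned`). Call a person positive if he or she favours the top of the ranking, and let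
p and q be the numbers of positive men and women.

Number the positive people downwards from 0 and the negative ones upwards, so that the topmost
negative man gets q - 1 and the topmost negative woman p - 1. Counting rivals shows that spouses in
a stable matching have the same index (`Aligned.card_rivals`, `Aligned.idx_eq`). An index has at
most one person of each sex and type, so it only remains to say where spouses agree in type, and
stability forces agreement exactly below some threshold x (`Aligned.exists_inCell_of_isStable`).

Let u count the positive men among the top q men, and v the positive women among the top p women. In
a quartet, the four people of one index k, the positive man is above the negative one iff k < u, and
the positive woman above the negative one iff k < v. If u ≤ v, then for u ≤ k < v the men favour
agreement and the women disagreement; for any other k one arrangement is blocked. So the stable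
matchings are the thresholds u ≤ x ≤ v (`Aligned.isStable_iff`), and the rotations are the steps
from k + 1 to k, exchanging partners in one quartet (`Aligned.exists_eq_swapCycle`). The men of
these quartets span nested intervals of `σ`, so the rotations form a chain
(`IsQuartet.explicitlyPrecedes_iff`). The case v ≤ u follows by symmetry (`Aligned.reverse`). The
answer |u - v| + 1 takes four counting passes over the lists. -/

namespace SMInstance

variable {n : ℕ}

/-! ### Ranks inside the two types of people -/

section Index

open Finset

/-- The number of people of type `t` strictly above `i`. -/
def above (σ : Equiv.Perm (Fin n)) (e : Fin n → Bool) (t : Bool) (i : Fin n) : ℕ :=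
  #{h | e h = t ∧ σ h < σ i}

/-- The number of people of positive type. -/
def posCount (e : Fin n → Bool) : ℕ := #{h | e h = true}

/-- The number of people of positive type among the first `m`. -/
def topCount (σ : Equiv.Perm (Fin n)) (e : Fin n → Bool) (m : ℕ) : ℕ :=
  #{h | e h = true ∧ (σ h : ℕ) < m}

/-- The index of a person: people of positive type are numbered downwards from `0`,
people of negative type are numbered upwards, the topmost one having the number `m - 1`. -/
def idx (σ : Equiv.Perm (Fin n)) (e : Fin n → Bool) (m : ℕ) (i : Fin n) : ℤ :=
  if e i then (above σ e true i : ℤ) else m - 1 - above σ e false i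

variable {σ : Equiv.Perm (Fin n)} {e : Fin n → Bool} {m : ℕ} {i h : Fin n} {t : Bool}

lemma above_lt_above (hi : e i = t) (hlt : σ i < σ h) : above σ e t i < above σ e t h := by
  refine card_lt_card ((ssubset_iff_of_subset ?_).2 ⟨i, by simp [hi, hlt], by simp⟩)
  intro x
  simp only [mem_filter, mem_univ, true_and]
  exact fun hx => ⟨hx.1, hx.2.trans hlt⟩

lemma above_lt_above_iff (hi : e i = t) (hh : e h = t) :
    above σ e t i < above σ e t h ↔ σ i < σ h := by
  refine ⟨fun hlt => ?_, above_lt_above hi⟩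
  by_contra hle
  rcases (not_lt.1 hle).lt_or_eq with hlt' | heq
  · exact (above_lt_above hh hlt').not_gt hlt
  · rw [σ.injective heq] at hlt
    exact hlt.false

lemma above_inj (hi : e i = t) (hh : e h = t) (heq : above σ e t i = above σ e t h) : i = h := by
  rcases lt_trichotomy (σ i) (σ h) with hlt | hlt | hlt
  · exact absurd heq (above_lt_above hi hlt).ne
  · exact σ.injective hlt
  · exact absurd heq (above_lt_above hh hlt).ne'

lemma above_lt_card (hi : e i = t) : above σ e t i < #{h | e h = t} := by
  refine card_lt_card ((ssubset_iff_of_subset ?_).2 ⟨i, by simp [hi], by simp⟩)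
  intro x
  simp only [mem_filter, mem_univ, true_and]
  exact fun hx => hx.1

lemma exists_above_eq {k : ℕ} (hk : k < #{h | e h = t}) : ∃ i, e i = t ∧ above σ e t i = k := by
  have := surjOn_of_injOn_of_card_le (s := {h | e h = t}) (t := range #{h | e h = t})
    (above σ e t) (fun i hi => by
      simp only [coe_filter, mem_univ, true_and, Set.mem_ofPred_eq] at hi
      simpa using above_lt_card hi)
    (fun i hi h hh heq => by
      simp only [coe_filter, mem_univ, true_and, Set.mem_ofPred_eq] at hi hh
      exact above_inj hi hh heq) (by simp)
  obtain ⟨i, hi, hik⟩ := this (by simpa using hk : k ∈ (range #{h | e h = t} : Set ℕ))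
  exact ⟨i, by simpa using hi, hik⟩

lemma card_neg : (#{h | e h = false} : ℤ) = n - posCount e := by
  have := card_filter_add_card_filter_not (s := (univ : Finset (Fin n))) (fun h => e h = true)
  simp only [Bool.not_eq_true, card_univ, Fintype.card_fin] at this
  rw [posCount]
  omega

lemma posCount_le (e : Fin n → Bool) : posCount e ≤ n := by
  rw [posCount]
  exact (card_le_univ _).trans_eq (Fintype.card_fin n)

lemma card_top (σ : Equiv.Perm (Fin n)) (hm : m ≤ n) : #{h | (σ h : ℕ) < m} = m := by
  rw [card_equiv (t := {x : Fin n | (x : ℕ) < m}) σ (by simp)]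
  rw [Fin.card_filter_val_lt]
  exact min_eq_right hm

lemma topCount_le_posCount : topCount σ e m ≤ posCount e :=
  card_le_card fun x => by simp +contextual

lemma topCount_le (hm : m ≤ n) : topCount σ e m ≤ m := by
  conv_rhs => rw [← card_top σ hm]
  exact card_le_card fun x => by simp +contextual

lemma card_top_neg (hm : m ≤ n) :
    (#{h | e h = false ∧ (σ h : ℕ) < m} : ℤ) = m - topCount σ e m := by
  have := card_filter_add_card_filter_not (s := ({h | (σ h : ℕ) < m} : Finset (Fin n)))
    (fun h => e h = true)
  rw [card_top σ hm, filter_filter, filter_filter] at this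
  simp only [Bool.not_eq_true, and_comm (a := (σ _ : ℕ) < m)] at this
  rw [topCount]
  omega

lemma le_topCount (hm : m ≤ n) : (posCount e + m - n : ℤ) ≤ topCount σ e m := by
  have h1 := card_top_neg (σ := σ) (e := e) hm
  have h2 := card_neg (e := e)
  have h3 : #{h | e h = false ∧ (σ h : ℕ) < m} ≤ #{h | e h = false} :=
    card_le_card fun x => by simp +contextual
  omega

lemma idx_pos (hi : e i = true) : idx σ e m i = above σ e true i := by simp [idx, hi]

lemma idx_neg (hi : e i = false) : idx σ e m i = m - 1 - above σ e false i := by simp [idx, hi]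

lemma idx_lt_idx_pos (hi : e i = true) (hh : e h = true) :
    idx σ e m i < idx σ e m h ↔ σ i < σ h := by
  rw [idx_pos hi, idx_pos hh, ← above_lt_above_iff hi hh]
  omega

lemma idx_lt_idx_neg (hi : e i = false) (hh : e h = false) :
    idx σ e m i < idx σ e m h ↔ σ h < σ i := by
  rw [idx_neg hi, idx_neg hh, ← above_lt_above_iff hh hi]
  omega

lemma idx_inj (he : e i = e h) (heq : idx σ e m i = idx σ e m h) : i = h := by
  cases hi : e i
  · rw [idx_neg hi, idx_neg (he ▸ hi)] at heq
    exact above_inj (σ := σ) hi (he ▸ hi) (by omega)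
  · rw [idx_pos hi, idx_pos (he ▸ hi)] at heq
    exact above_inj (σ := σ) hi (he ▸ hi) (by omega)

lemma idx_bounds_pos (hi : e i = true) : 0 ≤ idx σ e m i ∧ idx σ e m i < posCount e := by
  have := above_lt_card (σ := σ) hi
  rw [idx_pos hi, posCount]
  omega

lemma idx_bounds_neg (hi : e i = false) :
    (posCount e + m - n : ℤ) ≤ idx σ e m i ∧ idx σ e m i < m := by
  have := above_lt_card (σ := σ) hi
  have h2 := card_neg (e := e)
  rw [idx_neg hi]
  omega

lemma exists_idx_pos {k : ℤ} (h0 : 0 ≤ k) (hk : k < posCount e) :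
    ∃ i, e i = true ∧ idx σ e m i = k := by
  lift k to ℕ using h0
  obtain ⟨i, hi, hik⟩ := exists_above_eq (σ := σ) (e := e) (t := true) (k := k)
    (by rw [posCount] at hk; omega)
  exact ⟨i, hi, by rw [idx_pos hi, hik]⟩

lemma exists_idx_neg {k : ℤ} (h0 : (posCount e + m - n : ℤ) ≤ k) (hk : k < m) :
    ∃ i, e i = false ∧ idx σ e m i = k := by
  have h2 := card_neg (e := e)
  obtain ⟨i, hi, hik⟩ := exists_above_eq (σ := σ) (e := e) (t := false) (k := (m - 1 - k).toNat)
    (by omega)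
  exact ⟨i, hi, by rw [idx_neg hi, hik]; omega⟩

/-- A person of positive type is among the first `m` iff the index is small. -/
lemma lt_iff_idx_lt (hi : e i = true) : (σ i : ℕ) < m ↔ idx σ e m i < topCount σ e m := by
  rw [idx_pos hi, Nat.cast_lt]
  constructor
  · intro hlt
    refine card_lt_card ((ssubset_iff_of_subset ?_).2 ⟨i, by simp [hi, hlt], by simp⟩)
    intro x
    simp only [mem_filter, mem_univ, true_and]
    exact fun hx => ⟨hx.1, lt_trans hx.2 hlt⟩
  · contrapose!
    intro hle
    refine card_le_card fun x => ?_
    simp only [mem_filter, mem_univ, true_and]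
    exact fun hx => ⟨hx.1, Fin.lt_def.2 (hx.2.trans_le hle)⟩

/-- A person of negative type is among the first `m` iff the index is large. -/
lemma lt_iff_le_idx (hm : m ≤ n) (hi : e i = false) :
    (σ i : ℕ) < m ↔ (topCount σ e m : ℤ) ≤ idx σ e m i := by
  have h1 := card_top_neg (σ := σ) (e := e) hm
  rw [idx_neg hi]
  constructor
  · intro hlt
    have : above σ e false i < #{h | e h = false ∧ (σ h : ℕ) < m} := by
      refine card_lt_card ((ssubset_iff_of_subset ?_).2 ⟨i, by simp [hi, hlt], by simp⟩)
      intro x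
      simp only [mem_filter, mem_univ, true_and]
      exact fun hx => ⟨hx.1, lt_trans hx.2 hlt⟩
    omega
  · contrapose!
    intro hle
    have : #{h | e h = false ∧ (σ h : ℕ) < m} ≤ above σ e false i := by
      refine card_le_card fun x => ?_
      simp only [mem_filter, mem_univ, true_and]
      exact fun hx => ⟨hx.1, Fin.lt_def.2 (hx.2.trans_le hle)⟩
    omega

lemma card_below (hi : e i = t) :
    (#{h | e h = t ∧ σ i < σ h} : ℤ) = #{h | e h = t} - 1 - above σ e t i := by
  have h1 := card_filter_add_card_filter_not (s := ({h | e h = t} : Finset (Fin n)))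
    (fun h => σ h < σ i)
  have h2 : (univ.filter (fun h => e h = t)).filter (fun h => ¬ σ h < σ i) =
      insert i (univ.filter fun h => e h = t ∧ σ i < σ h) := by
    ext x
    simp only [mem_filter, mem_univ, true_and, mem_insert, not_lt]
    constructor
    · rintro ⟨hx, hle⟩
      rcases hle.lt_or_eq with hlt | heq
      · exact Or.inr ⟨hx, hlt⟩
      · exact Or.inl (σ.injective heq).symm
    · rintro (rfl | hx)
      · exact ⟨hi, le_rfl⟩
      · exact ⟨hx.1, hx.2.le⟩
  rw [h2, card_insert_of_notMem (by simp), filter_filter] at h1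
  rw [above]
  omega

end Index

end SMInstance

namespace SMInstance

variable {n : ℕ}

/-! ### Stable matchings of aligned instances -/

/-- The men are ranked by `σ` and the women by `τ`. People of positive type prefer the top of the
ranking of the opposite side, people of negative type prefer its bottom. -/
structure Aligned (I : SMInstance n) (σ τ : Equiv.Perm (Fin n)) (e f : Fin n → Bool) : Prop where
  man : ∀ i j l, I.ManPrefers i j l ↔ if e i then τ j < τ l else τ l < τ j
  woman : ∀ j i h, I.WomanPrefers j i h ↔ if f j then σ i < σ h else σ h < σ i

/-- Every man is matched to a woman of the same index, and the types of the two agree iff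
the index is less than `x`. -/
def InCell (σ τ : Equiv.Perm (Fin n)) (e f : Fin n → Bool) (x : ℤ) (μ : Equiv.Perm (Fin n)) :
    Prop :=
  ∀ i, idx τ f (posCount e) (μ i) = idx σ e (posCount f) i ∧
    (f (μ i) = true ↔ (e i = true ↔ idx σ e (posCount f) i < x))

/-- For mixed types only the cut at `m` is used: a positive person is above it iff the index is
below `topCount`, a negative one iff it is not. This reduces the study of blocking pairs to linear
arithmetic. -/
lemma idx_of_lt {σ : Equiv.Perm (Fin n)} {e : Fin n → Bool} {m : ℕ} (hm : m ≤ n) {a b : Fin n}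
    (hab : σ a < σ b) :
    (e a = true ∧ e b = true ∧ idx σ e m a < idx σ e m b) ∨
    (e a = false ∧ e b = false ∧ idx σ e m b < idx σ e m a) ∨
    (e a = true ∧ e b = false ∧
      ¬ (topCount σ e m ≤ idx σ e m a ∧ topCount σ e m ≤ idx σ e m b)) ∨
    (e a = false ∧ e b = true ∧
      ¬ (idx σ e m a < topCount σ e m ∧ idx σ e m b < topCount σ e m)) := by
  have hab' : (σ a : ℕ) < σ b := hab
  cases ha : e a <;> cases hb : e b
  · simpa using (idx_lt_idx_neg hb ha).2 hab
  · have h1 := lt_iff_le_idx (σ := σ) hm ha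
    have h2 := lt_iff_idx_lt (σ := σ) (m := m) hb
    simp only [reduceCtorEq, false_and, and_false, true_and, and_self, false_or]
    omega
  · have h1 := lt_iff_le_idx (σ := σ) hm hb
    have h2 := lt_iff_idx_lt (σ := σ) (m := m) ha
    simp only [reduceCtorEq, false_and, and_false, true_and, and_self, false_or, or_false]
    omega
  · simpa using (idx_lt_idx_pos ha hb).2 hab

/-! ### Stability in terms of indices and thresholds -/

namespace Aligned

variable {I : SMInstance n} {σ τ : Equiv.Perm (Fin n)} {e f : Fin n → Bool}

/-- A blocking pair gives one comparison in each ranking. By `idx_of_lt` both become inequalities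
between the indices of two couples, and each of the 16 type patterns contradicts the bounds on `x`.
-/
lemma isStable_of_inCell (H : I.Aligned σ τ e f) {x : ℤ} {μ : Equiv.Perm (Fin n)}
    (hu : topCount σ e (posCount f) ≤ x) (hv : x ≤ topCount τ f (posCount e))
    (hμ : InCell σ τ e f x μ) : I.IsStable μ := by
  rintro i j ⟨hm, hw⟩
  obtain ⟨h, rfl⟩ := μ.surjective j
  rw [μ.symm_apply_apply] at hw
  obtain ⟨hi1, hi2⟩ := hμ i
  obtain ⟨hh1, hh2⟩ := hμ h
  rw [H.man] at hm
  rw [H.woman] at hw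
  have c1 := fun a b => idx_of_lt (σ := τ) (e := f) (posCount_le e) (a := a) (b := b)
  have c2 := fun a b => idx_of_lt (σ := σ) (e := e) (posCount_le f) (a := a) (b := b)
  cases ei : e i <;> cases fj : f (μ h) <;>
    simp only [ei, fj, if_true, Bool.false_eq_true, if_false] at hm hw
  all_goals
    replace hm := c1 _ _ hm
    replace hw := c2 _ _ hw
    rw [hi1, hh1] at hm
    cases eh : e h <;> cases fi : f (μ i) <;>
    · simp only [ei, fj, eh, fi, reduceCtorEq, false_and, and_false, true_and, and_self, false_or,
        or_false, false_iff, true_iff, not_lt, not_le] at hi2 hh2 hm hw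
      try omega

/-- The bounds on `x` ensure that a woman of the prescribed index and type exists. Two men with the
same wife would share the index and hence the type. -/
lemma exists_inCell {x : ℤ} (h0 : 0 ≤ x) (h1 : x ≤ posCount e) (h2 : x ≤ posCount f)
    (h3 : (posCount e + posCount f - n : ℤ) ≤ x) : ∃ μ, InCell σ τ e f x μ := by
  have key : ∀ i, ∃ w, idx τ f (posCount e) w = idx σ e (posCount f) i ∧
    (f w = true ↔ (e i = true ↔ idx σ e (posCount f) i < x)) := by
    intro i
    cases ei : e i
    · have hb := idx_bounds_neg (σ := σ) (m := posCount f) ei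
      by_cases hx : idx σ e (posCount f) i < x
      · obtain ⟨w, hw, hk⟩ := exists_idx_neg (σ := τ) (e := f) (m := posCount e)
          (k := idx σ e (posCount f) i) (by omega) (by omega)
        exact ⟨w, hk, by simp [hw, hx]⟩
      · obtain ⟨w, hw, hk⟩ := exists_idx_pos (σ := τ) (e := f) (m := posCount e)
          (k := idx σ e (posCount f) i) (by omega) (by omega)
        exact ⟨w, hk, by simp [hw, hx]⟩
    · have hb := idx_bounds_pos (σ := σ) (m := posCount f) ei
      by_cases hx : idx σ e (posCount f) i < x
      · obtain ⟨w, hw, hk⟩ := exists_idx_pos (σ := τ) (e := f) (m := posCount e)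
          (k := idx σ e (posCount f) i) (by omega) (by omega)
        exact ⟨w, hk, by simp [hw, hx]⟩
      · obtain ⟨w, hw, hk⟩ := exists_idx_neg (σ := τ) (e := f) (m := posCount e)
          (k := idx σ e (posCount f) i) (by omega) (by omega)
        exact ⟨w, hk, by simp [hw, hx]⟩
  choose g hg using key
  have hinj : Function.Injective g := by
    intro a b hab
    have ha := hg a
    have hb := hg b
    rw [hab] at ha
    have hk := ha.1.symm.trans hb.1
    refine idx_inj (σ := σ) (m := posCount f) ?_ hk
    rw [hk, hb.2] at ha
    have := ha.2
    cases ea : e a <;> cases eb : e b <;> simp only [ea, eb, true_iff, false_iff, Bool.false_eq_true,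
      reduceCtorEq] at this ⊢ <;> omega
  exact ⟨Equiv.ofBijective g (Finite.injective_iff_bijective.1 hinj), hg⟩

lemma _root_.SMInstance.InCell.unique {x : ℤ} {μ ν : Equiv.Perm (Fin n)}
    (hμ : InCell σ τ e f x μ) (hν : InCell σ τ e f x ν) : μ = ν := by
  ext1 i
  refine idx_inj (σ := τ) (m := posCount e) ?_ ((hμ i).1.trans (hν i).1.symm)
  rw [Bool.eq_iff_iff, (hμ i).2, (hν i).2]

/-- If `x < y`, the positive man of index `x` would have a negative wife by the first threshold and
a positive one by the second. -/
lemma _root_.SMInstance.InCell.eq_of_eq {x y : ℤ} {μ : Equiv.Perm (Fin n)}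
    (hx : InCell σ τ e f x μ) (hy : InCell σ τ e f y μ)
    (hx0 : 0 ≤ x) (hxe : x ≤ posCount e) (hy0 : 0 ≤ y) (hye : y ≤ posCount e) : x = y := by
  wlog hlt : x < y generalizing x y
  · by_contra hne
    exact hne (this hy hx hy0 hye hx0 hxe (by omega)).symm
  obtain ⟨i, hi, hk⟩ := exists_idx_pos (σ := σ) (e := e) (m := posCount f) (k := x) hx0 (by omega)
  have h1 := (hx i).2
  have h2 := (hy i).2
  rw [h1, hk] at h2
  simp [hi, hlt] at h2

open Finset in
/-- A man's wife in a stable matching has as many rivals of her type whom he prefers to her as he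
has rivals of his type whom she prefers to him. -/
lemma card_rivals (H : I.Aligned σ τ e f) {μ : Equiv.Perm (Fin n)} (hμ : I.IsStable μ)
    (i : Fin n) :
    #{h | e h = e i ∧ if f (μ i) then σ h < σ i else σ i < σ h} =
      #{w | f w = f (μ i) ∧ if e i then τ w < τ (μ i) else τ (μ i) < τ w} := by
  -- The bijection is `μ` itself. If `μ i` prefers `h`, of the type of `i`, then `h` and therefore
  -- `i` prefers `μ h` to `μ i`; were `μ h` of the other type than `μ i`, she would prefer `i` to
  -- `h` and block with him. The converse is similar.
  refine card_equiv μ fun h => ?_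
  have s1 := hμ i (μ h)
  have s2 := hμ h (μ i)
  simp only [H.man, H.woman, μ.symm_apply_apply] at s1 s2
  simp only [mem_filter, mem_univ, true_and]
  by_cases hhi : h = i
  · subst hhi
    simp
  have t1 : (τ (μ h) : ℕ) ≠ τ (μ i) := fun hh => hhi (μ.injective (τ.injective (Fin.ext hh)))
  have t2 : (σ h : ℕ) ≠ σ i := fun hh => hhi (σ.injective (Fin.ext hh))
  cases ei : e i <;> cases eh : e h <;> cases fi : f (μ i) <;> cases fh : f (μ h) <;>
    simp only [ei, eh, fi, fh, if_true, if_false, Bool.false_eq_true, reduceCtorEq, true_and,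
      false_and, Fin.lt_def, iff_false, false_iff] at s1 s2 ⊢ <;>
    omega

-- `card_rivals` equates a rank, from the top or the bottom, on each side. The offset in `idx` makes
-- all four type combinations yield this one equation.
open Finset in
lemma idx_eq (H : I.Aligned σ τ e f) {μ : Equiv.Perm (Fin n)} (hμ : I.IsStable μ) (i : Fin n) :
    idx τ f (posCount e) (μ i) = idx σ e (posCount f) i := by
  have hc := H.card_rivals hμ i
  have b1 := card_below (σ := σ) (e := e) (i := i) rfl
  have b2 := card_below (σ := τ) (e := f) (i := μ i) rfl
  have n1 := card_neg (e := e)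
  have n2 := card_neg (e := f)
  have p1 : posCount e = #{h | e h = true} := rfl
  have p2 : posCount f = #{h | f h = true} := rfl
  cases ei : e i <;> cases fi : f (μ i) <;>
    simp only [ei, fi, if_true, if_false, Bool.false_eq_true] at hc b1 b2 <;>
    simp only [idx_pos, idx_neg, ei, fi] <;> simp only [above] at * <;> omega

-- The threshold is the number of couples with both members positive; their men are the topmost
-- positive ones. A negative man cannot have a wife of the same type as the wife of the positive man
-- of his index; where there is no such man, the ranges of the indices decide.
open Finset in
lemma exists_inCell_of_isStable (H : I.Aligned σ τ e f) {μ : Equiv.Perm (Fin n)}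
    (hμ : I.IsStable μ) : ∃ x : ℤ, 0 ≤ x ∧ x ≤ posCount e ∧ x ≤ posCount f ∧
      (posCount e + posCount f - n : ℤ) ≤ x ∧ InCell σ τ e f x μ := by
  have hk := H.idx_eq hμ
  have c0 : #{i | e i = true ∧ f (μ i) = true} + #{i | e i = true ∧ f (μ i) = false} =
      posCount e := by
    have := card_filter_add_card_filter_not (s := ({h | e h = true} : Finset (Fin n)))
      (fun h => f (μ h) = true)
    simpa [filter_filter, posCount] using this
  have c1 : #{i | e i = true ∧ f (μ i) = true} ≤ posCount f := by
    have : #{i | f (μ i) = true} = posCount f := card_equiv μ (by simp)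
    rw [← this]
    exact card_le_card fun x => by simp +contextual
  have c2 : #{i | e i = true ∧ f (μ i) = false} ≤ #{w | f w = false} := by
    have : #{i | f (μ i) = false} = #{w | f w = false} := card_equiv μ (by simp)
    rw [← this]
    exact card_le_card fun x => by simp +contextual
  have n2 := card_neg (e := f)
  set x := #{i | e i = true ∧ f (μ i) = true} with hx
  -- the men of positive type with wives of positive type are the topmost ones
  have mono : ∀ i h, e i = true → f (μ i) = true → e h = true → σ h < σ i → f (μ h) = true := by
    intro i h ei fi eh hlt
    by_contra fh
    have s1 := hμ i (μ h)
    have s2 := hμ h (μ i)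
    simp only [H.man, H.woman, μ.symm_apply_apply, ei, fi, eh, fh, if_true, hlt, if_false,
      and_true] at s1 s2
    have : τ (μ h) = τ (μ i) := le_antisymm (not_lt.1 s2) (not_lt.1 s1)
    exact hlt.ne (congrArg σ (μ.injective (τ.injective this)))
  have hpos : ∀ i, e i = true → (f (μ i) = true ↔ idx σ e (posCount f) i < x) := by
    intro i ei
    rw [idx_pos ei, Nat.cast_lt, above, hx]
    constructor
    · intro fi
      refine card_lt_card ((ssubset_iff_of_subset ?_).2 ⟨i, by simp [ei, fi], by simp⟩)
      intro h
      simp only [mem_filter, mem_univ, true_and]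
      exact fun hh => ⟨hh.1, mono i h ei fi hh.1 hh.2⟩
    · contrapose!
      intro fi
      refine card_le_card fun h => ?_
      simp only [mem_filter, mem_univ, true_and]
      refine fun hh => ⟨hh.1, ?_⟩
      by_contra hle
      rcases (not_lt.1 hle).lt_or_eq with hlt | heq
      · exact fi (mono h i hh.1 hh.2 ei hlt)
      · rw [σ.injective heq] at fi
        exact fi hh.2
  refine ⟨x, by omega, by omega, by omega, by omega, fun i => ⟨hk i, ?_⟩⟩
  cases ei : e i
  · have fb := idx_bounds_neg (σ := σ) (m := posCount f) ei
    simp only [Bool.false_eq_true, false_iff, not_lt]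
    -- the man of positive type with the same index decides
    have hother : ∀ h, e h = true → idx σ e (posCount f) h = idx σ e (posCount f) i →
        f (μ h) ≠ f (μ i) := fun h eh hh hf => by
      have := idx_inj (σ := τ) (m := posCount e) hf ((hk h).trans (hh.trans (hk i).symm))
      rw [μ.injective this, ei] at eh
      exact Bool.false_ne_true eh
    cases fi : f (μ i)
    · have wb := idx_bounds_neg (σ := τ) (m := posCount e) fi
      rw [hk] at wb
      simp only [Bool.false_eq_true, false_iff, not_le]
      by_contra hle
      obtain ⟨h, eh, hh⟩ := exists_idx_pos (σ := σ) (e := e) (m := posCount f)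
        (k := idx σ e (posCount f) i) (by omega) (by omega)
      have := hother h eh hh
      rw [fi, Ne, Bool.not_eq_false, hpos h eh, hh] at this
      omega
    · have wb := idx_bounds_pos (σ := τ) (m := posCount e) fi
      rw [hk] at wb
      simp only [true_iff]
      by_contra hle
      obtain ⟨h, eh, hh⟩ := exists_idx_pos (σ := σ) (e := e) (m := posCount f)
        (k := idx σ e (posCount f) i) (by omega) (by omega)
      have := hother h eh hh
      rw [fi, Ne, hpos h eh, hh] at this
      omega
  · simpa using hpos i ei

end Aligned

end SMInstance

/-! ### Rotations -/

/-! ### Cyclic lists -/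

namespace Cycle

variable {α : Type*} {r : α → α → Prop} {s : Cycle α} {x y a b : α}

lemma exists_eq_cons_of_mem (hx : x ∈ s) : ∃ l : List α, s = ((x :: l : List α) : Cycle α) := by
  induction s using Quotient.inductionOn' with
  | h l =>
    obtain ⟨l₁, l₂, rfl⟩ := List.append_of_mem (show x ∈ l from hx)
    exact ⟨l₂ ++ l₁, Cycle.coe_eq_coe.2 List.isRotated_append⟩

lemma Chain.rel_next [DecidableEq α] (h : s.Chain r) (hs : s.Nodup) (hx : x ∈ s) :
    r x (s.next hs x hx) := by
  obtain ⟨l, rfl⟩ := exists_eq_cons_of_mem hx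
  rcases l with _ | ⟨y, l⟩
  · have : Cycle.next ([x] : List α) hs x hx = x := List.next_singleton x x (by simp)
    rw [this]
    simpa using h
  · have : Cycle.next (x :: y :: l : List α) hs x hx = y :=
      List.next_cons_cons_eq l x y List.mem_cons_self
    rw [this]
    exact (List.isChain_cons_cons.1 h).1

lemma coe_cons_cons_eq_pair_iff {l : List α} :
    ((x :: y :: l : List α) : Cycle α) = (([a, b] : List α) : Cycle α) ↔
      l = [] ∧ (x = a ∧ y = b ∨ x = b ∧ y = a) := by
  rw [Cycle.coe_eq_coe]
  constructor
  · intro h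
    have hl := h.perm.length_eq
    simp only [List.length_cons, List.length_nil, zero_add, Nat.reduceAdd, Nat.add_eq_right,
      List.length_eq_zero_iff, add_assoc] at hl
    subst hl
    obtain ⟨k, hk⟩ := h
    rw [← List.rotate_mod] at hk
    rcases Nat.mod_two_eq_zero_or_one k with h0 | h0 <;> simp [h0] at hk <;> simp [hk]
  · rintro ⟨rfl, ⟨rfl, rfl⟩ | ⟨rfl, rfl⟩⟩
    · exact List.IsRotated.refl _
    · exact ⟨1, rfl⟩

end Cycle

namespace SMInstance

variable {n : ℕ}

lemma follows_pair_iff {p q a b : Fin n × Fin n} :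
    Follows (([a, b] : List _) : Cycle (Fin n × Fin n)) p q ↔ p = a ∧ q = b ∨ p = b ∧ q = a := by
  constructor
  · rintro ⟨l, hl⟩
    exact (Cycle.coe_cons_cons_eq_pair_iff.1 hl.symm).2
  · intro h
    exact ⟨[], (Cycle.coe_cons_cons_eq_pair_iff.2 ⟨rfl, h⟩).symm⟩

/-! ### Elimination of an exposed rotation -/

variable {I : SMInstance n}

lemma IsSuitor.unique {μ : Equiv.Perm (Fin n)} {i w w' : Fin n} (h : I.IsSuitor μ i w)
    (h' : I.IsSuitor μ i w') : w = w' := by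
  rcases h.2 w' h'.1 with h1 | h1
  · exact h1.symm
  rcases h'.2 w h.1 with h2 | h2
  · exact h2
  exact absurd h1 (lt_asymm h2)

/-- Eliminating a rotation which is exposed in a stable matching yields a stable matching. -/
lemma IsStable.exists_eliminate {μ : Equiv.Perm (Fin n)} (hμ : I.IsStable μ)
    {R : Cycle (Fin n × Fin n)} (hR : I.Exposed μ R) :
    ∃ ν, I.IsStable ν ∧ ν ≠ μ ∧ ∀ i, ν i ≠ μ i → (i, μ i) ∈ R ∧ I.ManPrefers i (μ i) (ν i) := by
  obtain ⟨hnil, hnd, hmem, hch⟩ := hR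
  -- `π` advances the pairs of the rotation and fixes all others, so the new wife of `i` is the
  -- woman of `π (i, μ i)`.
  set π := Cycle.formPerm R hnd
  have hπ : ∀ i, (i, μ i) ∈ R → π (i, μ i) ∈ R ∧ I.IsSuitor μ i (π (i, μ i)).2 := by
    intro i hi
    rw [Cycle.formPerm_apply_mem_eq_next R hnd _ hi]
    exact ⟨Cycle.next_mem _ _ _ _, hch.rel_next hnd hi⟩
  have hπ' : ∀ i, (i, μ i) ∉ R → π (i, μ i) = (i, μ i) := fun i hi =>
    Cycle.formPerm_eq_self_of_notMem R hnd _ hi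
  have hgraph : ∀ i, μ (π (i, μ i)).1 = (π (i, μ i)).2 := by
    intro i
    by_cases hi : (i, μ i) ∈ R
    · exact hmem _ (hπ i hi).1
    · rw [hπ' i hi]
  have hinj : Function.Injective fun i => (π (i, μ i)).2 := by
    intro i h heq
    have h1 : π (i, μ i) = π (h, μ h) :=
      Prod.ext (μ.injective ((hgraph i).trans (heq.trans (hgraph h).symm))) heq
    exact congrArg Prod.fst (π.injective h1)
  set ν := Equiv.ofBijective _ (Finite.injective_iff_bijective.1 hinj) with hν
  have hνi : ∀ i, ν i = (π (i, μ i)).2 := fun i => rfl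
  have hmove : ∀ i, ν i ≠ μ i → (i, μ i) ∈ R := by
    intro i hi
    by_contra hn
    rw [hνi, hπ' i hn] at hi
    exact hi rfl
  have hsuit : ∀ i, (i, μ i) ∈ R → I.IsSuitor μ i (ν i) := fun i hi => (hπ i hi).2
  refine ⟨ν, ?_, ?_, fun i hi => ⟨hmove i hi, (hsuit i (hmove i hi)).1.1⟩⟩
  · rintro i j ⟨hm, hw⟩
    obtain ⟨h, rfl⟩ := ν.surjective j
    rw [ν.symm_apply_apply] at hw
    -- the woman's partner has not become worse
    have hw' : I.WomanPrefers (ν h) i (μ.symm (ν h)) := by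
      by_cases hh : ν h = μ h
      · rwa [hh, μ.symm_apply_apply, ← hh]
      · exact lt_trans hw (hsuit h (hmove h hh)).1.2
    have hne : μ i ≠ ν h := by
      intro heq
      rw [← heq, μ.symm_apply_apply] at hw'
      exact lt_irrefl _ hw'
    have hpref : I.ManPrefers i (μ i) (ν h) := by
      rcases lt_trichotomy ((I.men i).symm (μ i)) ((I.men i).symm (ν h)) with hlt | heq | hlt
      · exact hlt
      · exact absurd ((I.men i).symm.injective heq) hne
      · exact absurd ⟨hlt, hw'⟩ (hμ i (ν h))
    -- Now `ν h` is a suitor candidate of `i`. A man who moves gets his first candidate, and one who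
    -- stays prefers his wife to `ν h`.
    by_cases hi : ν i = μ i
    · rw [hi] at hm
      exact lt_asymm hm hpref
    · rcases (hsuit i (hmove i hi)).2 (ν h) ⟨hpref, hw'⟩ with heq | hlt
      · rw [heq] at hm
        exact lt_irrefl _ hm
      · exact lt_asymm hm hlt
  · intro heq
    obtain ⟨p, hp⟩ : ∃ p, p ∈ R := by
      induction R using Quotient.inductionOn' with
      | h l =>
        rcases l with _ | ⟨p, l⟩
        · exact absurd rfl hnil
        · exact ⟨p, by simp [Cycle.mk''_eq_coe]⟩
    have hp' : (p.1, μ p.1) ∈ R := by rwa [hmem p hp]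
    have := (hsuit p.1 hp').1.1
    rw [heq] at this
    exact lt_irrefl _ this

/-- `a` and `b` are the men and `c` and `d` the women of index `k`, `a` and `c` being of positive
type. -/
structure IsQuartet (σ τ : Equiv.Perm (Fin n)) (e f : Fin n → Bool) (k : ℤ) (a b c d : Fin n) :
    Prop where
  ea : e a = true
  eb : e b = false
  fc : f c = true
  fd : f d = false
  ka : idx σ e (posCount f) a = k
  kb : idx σ e (posCount f) b = k
  kc : idx τ f (posCount e) c = k
  kd : idx τ f (posCount e) d = k

/-- The rotation in which the members of a quartet exchange their partners. -/
def swapCycle (a b c d : Fin n) : Cycle (Fin n × Fin n) := ([(a, c), (b, d)] : List _)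

/-! ### Quartets and the exchanges in them -/

section

variable {σ τ : Equiv.Perm (Fin n)} {e f : Fin n → Bool} {k k' x : ℤ}
  {a b c d a' b' c' d' : Fin n} {μ : Equiv.Perm (Fin n)}

lemma exists_isQuartet_of_bounds (h0 : 0 ≤ k) (he : k < posCount e) (hf : k < posCount f)
    (hn : (posCount e + posCount f - n : ℤ) ≤ k) : ∃ a b c d, IsQuartet σ τ e f k a b c d := by
  obtain ⟨a, ea, ka⟩ := exists_idx_pos (σ := σ) (e := e) (m := posCount f) h0 he
  obtain ⟨b, eb, kb⟩ := exists_idx_neg (σ := σ) (e := e) (m := posCount f) hn hf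
  obtain ⟨c, fc, kc⟩ := exists_idx_pos (σ := τ) (e := f) (m := posCount e) h0 hf
  obtain ⟨d, fd, kd⟩ := exists_idx_neg (σ := τ) (e := f) (m := posCount e) (k := k) (by omega) he
  exact ⟨a, b, c, d, ea, eb, fc, fd, ka, kb, kc, kd⟩

lemma exists_isQuartet (h1 : (topCount σ e (posCount f) : ℤ) ≤ k)
    (h2 : k < topCount τ f (posCount e)) : ∃ a b c d, IsQuartet σ τ e f k a b c d := by
  have := topCount_le_posCount (σ := τ) (e := f) (m := posCount e)
  have := topCount_le (σ := τ) (e := f) (posCount_le e)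
  have := le_topCount (σ := σ) (e := e) (posCount_le f)
  exact exists_isQuartet_of_bounds (by omega) (by omega) (by omega) (by omega)

namespace IsQuartet

variable (Q : IsQuartet σ τ e f k a b c d)
include Q

lemma wife_of_lt (hμ : InCell σ τ e f x μ) (hk : k < x) : μ a = c ∧ μ b = d := by
  have ha := hμ a
  have hb := hμ b
  rw [Q.ka, Q.ea] at ha
  rw [Q.kb, Q.eb] at hb
  refine ⟨idx_inj (σ := τ) (m := posCount e) ?_ (ha.1.trans Q.kc.symm),
    idx_inj (σ := τ) (m := posCount e) ?_ (hb.1.trans Q.kd.symm)⟩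
  · rw [Q.fc, ha.2]
    simp [hk]
  · rw [Q.fd, ← Bool.not_eq_true, hb.2]
    simp [hk]

lemma wife_of_le (hμ : InCell σ τ e f x μ) (hk : x ≤ k) : μ a = d ∧ μ b = c := by
  have ha := hμ a
  have hb := hμ b
  rw [Q.ka, Q.ea] at ha
  rw [Q.kb, Q.eb] at hb
  refine ⟨idx_inj (σ := τ) (m := posCount e) ?_ (ha.1.trans Q.kd.symm),
    idx_inj (σ := τ) (m := posCount e) ?_ (hb.1.trans Q.kc.symm)⟩
  · rw [Q.fd, ← Bool.not_eq_true, ha.2]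
    simp [hk]
  · rw [Q.fc, hb.2]
    simp [hk]

/-- The cut after the top `posCount f` men separates the two, whatever their indices. -/
lemma man_lt (h1 : (topCount σ e (posCount f) : ℤ) ≤ k)
    (Q' : IsQuartet σ τ e f k' a' b' c' d') (h1' : (topCount σ e (posCount f) : ℤ) ≤ k') :
    σ b < σ a' := by
  have hb := lt_iff_le_idx (σ := σ) (posCount_le f) Q.eb
  have ha := lt_iff_idx_lt (σ := σ) (m := posCount f) Q'.ea
  rw [Q.kb] at hb
  rw [Q'.ka] at ha
  rw [Fin.lt_def]
  omega

lemma woman_lt (h2 : k < topCount τ f (posCount e)) (Q' : IsQuartet σ τ e f k' a' b' c' d')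
    (h2' : k' < topCount τ f (posCount e)) : τ c < τ d' := by
  have hd := lt_iff_le_idx (σ := τ) (posCount_le e) Q'.fd
  have hc := lt_iff_idx_lt (σ := τ) (m := posCount e) Q.fc
  rw [Q'.kd] at hd
  rw [Q.kc] at hc
  rw [Fin.lt_def]
  omega

/-- The quartet agrees in type, which its men favour and its women do not, so `d` and `c` are
candidates. A candidate ranked earlier would lie strictly between wife and claimed suitor; the
indices exclude this because `k + 1` is the least threshold at which this quartet agrees. -/
lemma isSuitor (H : I.Aligned σ τ e f) (h1 : (topCount σ e (posCount f) : ℤ) ≤ k)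
    (h2 : k < topCount τ f (posCount e)) (hμ : InCell σ τ e f (k + 1) μ) :
    I.IsSuitor μ a d ∧ I.IsSuitor μ b c := by
  obtain ⟨hac, hbd⟩ := Q.wife_of_lt hμ (by omega)
  have hba := Q.man_lt h1 Q h1
  have hcd := Q.woman_lt h2 Q h2
  have hsd : μ.symm d = b := by rw [← hbd, μ.symm_apply_apply]
  have hsc : μ.symm c = a := by rw [← hac, μ.symm_apply_apply]
  have c1 := fun a b => idx_of_lt (σ := τ) (e := f) (posCount_le e) (a := a) (b := b)
  have c2 := fun a b => idx_of_lt (σ := σ) (e := e) (posCount_le f) (a := a) (b := b)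
  constructor
  · refine ⟨⟨by simp [H.man, Q.ea, hac, hcd], by simp [H.woman, Q.fd, hsd, hba]⟩, fun w' hw' => ?_⟩
    obtain ⟨h, rfl⟩ := μ.surjective w'
    obtain ⟨hm, hw⟩ := hw'
    rw [μ.symm_apply_apply, H.woman] at hw
    rw [H.man, if_pos Q.ea] at hm ⊢
    by_contra! hcon
    have hlt := c1 _ _ (hcon.2.lt_of_ne fun hh => hcon.1 (τ.injective hh))
    replace hm := c1 _ _ hm
    obtain ⟨hh1, hh2⟩ := hμ h
    rw [hac, Q.kc, hh1] at hm
    rw [Q.kd, hh1] at hlt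
    cases eh : e h <;> cases fh : f (μ h) <;>
    · simp only [fh, if_true, Bool.false_eq_true, if_false] at hw
      replace hw := c2 _ _ hw
      simp only [eh, fh, Q.ea, Q.fc, Q.fd, Q.ka, reduceCtorEq, false_and, and_false, true_and,
        false_or, or_false, false_iff, true_iff, not_lt, or_self] at hh2 hm hw hlt
      try omega
  · refine ⟨⟨by simp [H.man, Q.eb, hbd, hcd], by simp [H.woman, Q.fc, hsc, hba]⟩, fun w' hw' => ?_⟩
    obtain ⟨h, rfl⟩ := μ.surjective w'
    obtain ⟨hm, hw⟩ := hw'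
    rw [μ.symm_apply_apply, H.woman] at hw
    simp only [H.man, Q.eb, Bool.false_eq_true, if_false] at hm ⊢
    by_contra! hcon
    have hlt := c1 _ _ (hcon.2.lt_of_ne fun hh => hcon.1 (τ.injective hh.symm))
    replace hm := c1 _ _ hm
    obtain ⟨hh1, hh2⟩ := hμ h
    rw [hbd, Q.kd, hh1] at hm
    rw [Q.kc, hh1] at hlt
    cases eh : e h <;> cases fh : f (μ h) <;>
    · simp only [fh, if_true, Bool.false_eq_true, if_false] at hw
      replace hw := c2 _ _ hw
      simp only [eh, fh, Q.eb, Q.fc, Q.fd, Q.kb, reduceCtorEq, false_and, and_false, true_and,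
        false_or, or_false, false_iff, true_iff, not_lt, or_self] at hh2 hm hw hlt
      try omega

lemma exposed (H : I.Aligned σ τ e f) (h1 : (topCount σ e (posCount f) : ℤ) ≤ k)
    (h2 : k < topCount τ f (posCount e)) (hμ : InCell σ τ e f (k + 1) μ) :
    I.Exposed μ (swapCycle a b c d) := by
  obtain ⟨hac, hbd⟩ := Q.wife_of_lt hμ (by omega)
  obtain ⟨s1, s2⟩ := Q.isSuitor H h1 h2 hμ
  have hab : a ≠ b := by
    rintro rfl
    exact absurd (Q.ea.symm.trans Q.eb) (by simp)
  refine ⟨by simp [swapCycle], by simp [swapCycle, hab], ?_, ?_⟩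
  · intro p hp
    simp only [swapCycle, Cycle.mem_coe_iff, List.mem_cons, List.not_mem_nil, or_false] at hp
    rcases hp with rfl | rfl
    exacts [hac, hbd]
  · simp [swapCycle, s1, s2]

lemma eq_of_eq (Q' : IsQuartet σ τ e f k a' b' c' d') : a = a' ∧ b = b' ∧ c = c' ∧ d = d' :=
  ⟨idx_inj (Q.ea.trans Q'.ea.symm) (Q.ka.trans Q'.ka.symm),
    idx_inj (Q.eb.trans Q'.eb.symm) (Q.kb.trans Q'.kb.symm),
    idx_inj (Q.fc.trans Q'.fc.symm) (Q.kc.trans Q'.kc.symm),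
    idx_inj (Q.fd.trans Q'.fd.symm) (Q.kd.trans Q'.kd.symm)⟩

lemma swapCycle_eq_iff (Q' : IsQuartet σ τ e f k' a' b' c' d') :
    swapCycle a b c d = swapCycle a' b' c' d' ↔ k = k' := by
  constructor
  · intro h
    rcases (Cycle.coe_cons_cons_eq_pair_iff.1 h).2 with ⟨h1, -⟩ | ⟨h1, -⟩
    · rw [← Q.ka, ← Q'.ka, show a = a' from congrArg Prod.fst h1]
    · have := Q.ea
      rw [show a = b' from congrArg Prod.fst h1, Q'.eb] at this
      cases this
  · rintro rfl
    obtain ⟨rfl, rfl, rfl, rfl⟩ := Q.eq_of_eq Q'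
    rfl

/-- The men `b` and `a` bound an interval of `σ` that grows with `k`. `R` only eliminates pairs with
men in its interval, and for `k < k'` both `a'` and `b'` lie outside. For `k' < k` the man `a'` lies
strictly inside, so `R` eliminates `(a', c)`, while `R'` moves `a'` to `d'`, below `c`. -/
lemma explicitlyPrecedes_iff (H : I.Aligned σ τ e f)
    (h1 : (topCount σ e (posCount f) : ℤ) ≤ k) (h2 : k < topCount τ f (posCount e))
    (Q' : IsQuartet σ τ e f k' a' b' c' d')
    (h1' : (topCount σ e (posCount f) : ℤ) ≤ k') (h2' : k' < topCount τ f (posCount e))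
    {R R' : I.Rotation} (hR : R.1 = swapCycle a b c d) (hR' : R'.1 = swapCycle a' b' c' d') :
    I.ExplicitlyPrecedes R R' ↔ k' < k := by
  have hne : R ≠ R' ↔ k ≠ k' := by
    rw [Ne, show R = R' ↔ R.1 = R'.1 from Subtype.ext_iff, hR, hR', Q.swapCycle_eq_iff Q']
  rw [ExplicitlyPrecedes, hne, hR, hR']
  simp only [Eliminates, swapCycle, follows_pair_iff]
  constructor
  · rintro ⟨hkk, M, w, ⟨p, q, hpq, rfl, hM, hM'⟩, p', q', hpq', rfl, -⟩
    by_contra hle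
    have hlt : k < k' := by omega
    have hσa : σ a < σ a' := (idx_lt_idx_pos Q.ea Q'.ea).1 (by rw [Q.ka, Q'.ka]; exact hlt)
    have hσb : σ b' < σ b := (idx_lt_idx_neg Q.eb Q'.eb).1 (by rw [Q.kb, Q'.kb]; exact hlt)
    have hba := Q.man_lt h1 Q h1
    have hba' := Q'.man_lt h1' Q' h1'
    rcases hpq with ⟨rfl, rfl⟩ | ⟨rfl, rfl⟩ <;> rcases hpq' with ⟨rfl, rfl⟩ | ⟨rfl, rfl⟩ <;>
      simp only [H.woman, Q.fc, Q.fd, if_true, Bool.false_eq_true, if_false] at hM hM' <;>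
      rcases hM with rfl | hM <;> rw [Fin.lt_def] at * <;> omega
  · intro hlt
    have hσa : σ a' < σ a := (idx_lt_idx_pos Q'.ea Q.ea).1 (by rw [Q.ka, Q'.ka]; exact hlt)
    refine ⟨hlt.ne', a', c, ⟨(b, d), (a, c), Or.inr ⟨rfl, rfl⟩, rfl, Or.inr ?_, ?_⟩,
      (a', c'), (b', d'), Or.inl ⟨rfl, rfl⟩, rfl, ?_⟩
    · simpa [H.woman, Q.fc] using hσa
    · simpa [H.woman, Q.fc] using Q.man_lt h1 Q' h1'
    · simpa [H.man, Q'.ea] using Q.woman_lt h2 Q' h2'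

end IsQuartet

namespace Aligned

/-- In an aligned instance where the men benefit from pairs of equal types, the stable matchings
are parametrized by an interval. -/
lemma isStable_iff (H : I.Aligned σ τ e f)
    (huv : topCount σ e (posCount f) ≤ topCount τ f (posCount e)) :
    I.IsStable μ ↔ ∃ x : ℤ, topCount σ e (posCount f) ≤ x ∧ x ≤ topCount τ f (posCount e) ∧
      InCell σ τ e f x μ := by
  constructor
  swap
  · rintro ⟨x, h1, h2, hμ⟩
    exact H.isStable_of_inCell h1 h2 hμ
  intro hs
  obtain ⟨x, h0, he, hf, hc, hμ⟩ := H.exists_inCell_of_isStable hs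
  have := topCount_le_posCount (σ := τ) (e := f) (m := posCount e)
  have := topCount_le_posCount (σ := σ) (e := e) (m := posCount f)
  have := topCount_le (σ := τ) (e := f) (posCount_le e)
  have := topCount_le (σ := σ) (e := e) (posCount_le f)
  have := le_topCount (σ := σ) (e := e) (posCount_le f)
  have := le_topCount (σ := τ) (e := f) (posCount_le e)
  -- a quartet on the wrong side of an end of the interval contains a blocking pair
  refine ⟨x, ?_, ?_, hμ⟩
  · by_contra hlt
    obtain ⟨a, b, c, d, Q⟩ := exists_isQuartet_of_bounds (σ := σ) (τ := τ) (e := e) (f := f)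
      (k := x) h0 (by omega) (by omega) hc
    obtain ⟨had, hbc⟩ := Q.wife_of_le hμ le_rfl
    have hcd := Q.woman_lt (by omega) Q (by omega)
    refine hs a c ?_
    have hsc : μ.symm c = b := by rw [← hbc, μ.symm_apply_apply]
    simp only [H.man, H.woman, Q.ea, Q.fc, if_true, had, hsc, hcd, true_and]
    have hb := lt_iff_le_idx (σ := σ) (posCount_le f) Q.eb
    have ha := lt_iff_idx_lt (σ := σ) (m := posCount f) Q.ea
    rw [Q.kb] at hb
    rw [Q.ka] at ha
    rw [Fin.lt_def]
    omega
  · by_contra hlt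
    -- Index `x - 1` is the last at which types agree; beyond the upper end `a` and `d` prefer each
    -- other.
    obtain ⟨a, b, c, d, Q⟩ := exists_isQuartet_of_bounds (σ := σ) (τ := τ) (e := e) (f := f)
      (k := x - 1) (by omega) (by omega) (by omega) (by omega)
    obtain ⟨hac, hbd⟩ := Q.wife_of_lt hμ (by omega)
    have hba := Q.man_lt (by omega) Q (by omega)
    refine hs a d ?_
    have hsd : μ.symm d = b := by rw [← hbd, μ.symm_apply_apply]
    simp only [H.man, H.woman, Q.ea, Q.fd, if_true, hac, hsd, hba, Bool.false_eq_true, if_false,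
      and_true]
    have hd := lt_iff_le_idx (σ := τ) (posCount_le e) Q.fd
    have hc := lt_iff_idx_lt (σ := τ) (m := posCount e) Q.fc
    rw [Q.kd] at hd
    rw [Q.kc] at hc
    rw [Fin.lt_def]
    omega

/-- Every rotation of such an instance is the exchange in some quartet. -/
lemma exists_eq_swapCycle (H : I.Aligned σ τ e f)
    (huv : topCount σ e (posCount f) ≤ topCount τ f (posCount e)) (R : I.Rotation) :
    ∃ k : ℤ, topCount σ e (posCount f) ≤ k ∧ k < topCount τ f (posCount e) ∧
      ∃ a b c d, IsQuartet σ τ e f k a b c d ∧ R.1 = swapCycle a b c d := by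
  obtain ⟨R, μ, hs, hR⟩ := R
  obtain ⟨x, hx1, hx2, hx⟩ := (H.isStable_iff huv).1 hs
  obtain ⟨ν, hν, hne, hmove⟩ := hs.exists_eliminate hR
  obtain ⟨y, hy1, hy2, hy⟩ := (H.isStable_iff huv).1 hν
  -- Elimination only makes men worse off, whereas a higher threshold would give the positive man of
  -- index `x` a better wife.
  have hxy : y < x := by
    rcases lt_trichotomy y x with hlt | rfl | hlt
    · exact hlt
    · exact absurd (hy.unique hx) hne
    · obtain ⟨a, b, c, d, Q⟩ := exists_isQuartet (σ := σ) (τ := τ) (e := e) (f := f) (k := x)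
        hx1 (by omega)
      have hcd := Q.woman_lt (by omega) Q (by omega)
      have h1 := (Q.wife_of_le hx le_rfl).1
      have h2 := (Q.wife_of_lt hy hlt).1
      have := (hmove a (by rw [h1, h2]; rintro rfl; exact lt_irrefl _ hcd)).2
      rw [h1, h2, H.man, if_pos Q.ea] at this
      exact absurd this (lt_asymm hcd)
  obtain ⟨a, b, c, d, Q⟩ := exists_isQuartet (σ := σ) (τ := τ) (e := e) (f := f) (k := x - 1)
    (by omega) (by omega)
  refine ⟨x - 1, by omega, by omega, a, b, c, d, Q, ?_⟩
  have hcd := Q.woman_lt (by omega) Q (by omega)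
  obtain ⟨hac, hbd⟩ := Q.wife_of_lt hx (by omega)
  have had := (Q.wife_of_le hy (by omega)).1
  have hmem := (hmove a (by rw [hac, had]; rintro rfl; exact lt_irrefl _ hcd)).1
  rw [hac] at hmem
  obtain ⟨s1, s2⟩ := Q.isSuitor H (by omega) (by omega) (by simpa using hx)
  -- From `(a, c)` the suitors force `(b, d)` and then `(a, c)` again, so the cycle closes, its
  -- pairs being distinct.
  obtain ⟨l, rfl⟩ := Cycle.exists_eq_cons_of_mem hmem
  obtain ⟨-, hnd, hmarried, hch⟩ := hR
  have hb : ∀ q : Fin n × Fin n, μ q.1 = q.2 → q.2 = d → q = (b, d) := fun q h1 h2 =>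
    Prod.ext (μ.injective (by rw [h1, h2, hbd])) h2
  have ha : ∀ q : Fin n × Fin n, μ q.1 = q.2 → q.2 = c → q = (a, c) := fun q h1 h2 =>
    Prod.ext (μ.injective (by rw [h1, h2, hac])) h2
  rw [Cycle.chain_coe_cons] at hch
  rcases l with _ | ⟨q, l⟩
  · have : I.IsSuitor μ a c := by simpa using hch
    exact absurd (this.unique s1) (by rintro rfl; exact lt_irrefl _ hcd)
  · simp only [List.cons_append, List.isChain_cons_cons] at hch
    obtain rfl : q = (b, d) := hb q (hmarried q (by simp)) (hch.1.unique s1)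
    rcases l with _ | ⟨r, l⟩
    · rfl
    · simp only [List.cons_append, List.isChain_cons_cons] at hch
      obtain rfl : r = (a, c) := ha r (hmarried r (by simp)) (hch.2.1.unique s2)
      simp at hnd

end Aligned

end

end SMInstance

namespace SMInstance

variable {n : ℕ} {I : SMInstance n} {σ τ : Equiv.Perm (Fin n)} {e f : Fin n → Bool}

/-! ### Counting -/

namespace Aligned

lemma numStable_of_le (H : I.Aligned σ τ e f)
    (huv : topCount σ e (posCount f) ≤ topCount τ f (posCount e)) :
    I.numStable = topCount τ f (posCount e) - topCount σ e (posCount f) + 1 := by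
  have u1 := topCount_le_posCount (σ := σ) (e := e) (m := posCount f)
  have v1 := topCount_le_posCount (σ := τ) (e := f) (m := posCount e)
  have v2 := topCount_le (σ := τ) (e := f) (posCount_le e)
  have u3 := le_topCount (σ := σ) (e := e) (posCount_le f)
  set u := topCount σ e (posCount f) with hu
  set v := topCount τ f (posCount e) with hv
  have hex : ∀ k : Fin (v - u + 1), ∃ μ, InCell σ τ e f ((u + k : ℕ) : ℤ) μ := fun k =>
    exists_inCell (by omega) (by omega) (by omega) (by omega)
  choose g hg using hex
  have hs : ∀ k, I.IsStable (g k) := fun k =>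
    (H.isStable_iff huv).2 ⟨_, by omega, by omega, hg k⟩
  rw [numStable, ← Nat.card_fin (v - u + 1)]
  refine (Nat.card_eq_of_bijective (fun k => ⟨g k, hs k⟩)
    ⟨fun k k' hk => ?_, fun ⟨μ, hμ⟩ => ?_⟩).symm
  · have hk' : g k = g k' := congrArg Subtype.val hk
    have h1 := hg k
    rw [hk'] at h1
    have := h1.eq_of_eq (hg k') (by omega) (by omega) (by omega) (by omega)
    exact Fin.ext (by omega)
  · obtain ⟨x, h1, h2, hx⟩ := (H.isStable_iff huv).1 hμ
    refine ⟨⟨(x - u).toNat, by omega⟩, Subtype.ext ?_⟩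
    refine (hg _).unique ?_
    convert hx using 1
    simp only
    omega

lemma exists_equiv_of_le (H : I.Aligned σ τ e f)
    (huv : topCount σ e (posCount f) ≤ topCount τ f (posCount e)) :
    ∃ g : I.Rotation ≃ Fin (topCount τ f (posCount e) - topCount σ e (posCount f)),
      ∀ R R', I.ExplicitlyPrecedes R R' ↔ g R < g R' := by
  have u1 := topCount_le_posCount (σ := σ) (e := e) (m := posCount f)
  have v1 := topCount_le_posCount (σ := τ) (e := f) (m := posCount e)
  have v2 := topCount_le (σ := τ) (e := f) (posCount_le e)
  have u3 := le_topCount (σ := σ) (e := e) (posCount_le f)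
  set u := topCount σ e (posCount f) with hu
  set v := topCount τ f (posCount e) with hv
  have hex : ∀ k : Fin (v - u), ∃ a b c d,
      IsQuartet σ τ e f ((u + k : ℕ) : ℤ) a b c d := fun k =>
    exists_isQuartet (by omega) (by omega)
  choose a b c d Q using hex
  have hrot : ∀ k : Fin (v - u), ∃ μ, I.IsStable μ ∧
      I.Exposed μ (swapCycle (a k) (b k) (c k) (d k)) := by
    intro k
    obtain ⟨μ, hμ⟩ := exists_inCell (σ := σ) (τ := τ) (e := e) (f := f)
      (x := ((u + k : ℕ) : ℤ) + 1) (by omega) (by omega) (by omega) (by omega)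
    exact ⟨μ, (H.isStable_iff huv).2 ⟨_, by omega, by omega, hμ⟩,
      (Q k).exposed H (by omega) (by omega) hμ⟩
  let g : Fin (v - u) → I.Rotation := fun k => ⟨_, hrot k⟩
  have hg : Function.Bijective g := by
    constructor
    · intro k k' hk
      have := ((Q k).swapCycle_eq_iff (Q k')).1 (congrArg Subtype.val hk)
      exact Fin.ext (by omega)
    · intro R
      obtain ⟨k, h1, h2, a', b', c', d', Q', hR⟩ := H.exists_eq_swapCycle huv R
      refine ⟨⟨(k - u).toNat, by omega⟩, Subtype.ext ?_⟩
      rw [hR]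
      refine ((Q _).swapCycle_eq_iff Q').2 ?_
      simp only
      omega
  -- Rotations of larger index come earlier, hence the reversal.
  refine ⟨(Equiv.ofBijective g hg).symm.trans Fin.revPerm, fun R R' => ?_⟩
  obtain ⟨k, rfl⟩ := hg.2 R
  obtain ⟨k', rfl⟩ := hg.2 R'
  rw [(Q k).explicitlyPrecedes_iff H (by omega) (by omega) (Q k') (by omega) (by omega) rfl rfl]
  have h1 : ∀ k, (Equiv.ofBijective g hg).symm (g k) = k := fun k =>
    (Equiv.ofBijective g hg).symm_apply_apply k
  simp only [Equiv.trans_apply, h1, Fin.revPerm_apply, Fin.rev_lt_rev]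
  rw [Fin.lt_def]
  omega

/-- Reversing the ranking of the men and exchanging the two types of women does not change the
preferences. -/
lemma reverse (H : I.Aligned σ τ e f) :
    I.Aligned (σ.trans Fin.revPerm) τ e (fun j => !f j) where
  man := H.man
  woman j i h := by
    rw [H.woman]
    cases f j <;> simp

end Aligned

lemma posCount_not (f : Fin n → Bool) : (posCount (fun j => !f j) : ℤ) = n - posCount f := by
  rw [← card_neg]
  simp [posCount]

lemma topCount_not {m : ℕ} (hm : m ≤ n) :
    (topCount τ (fun j => !f j) m : ℤ) = m - topCount τ f m := by
  rw [← card_top_neg hm]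
  simp [topCount]

-- The top men of the reversed ranking, as many as there are negative women, are those outside the
-- former top `posCount f`.
open Finset in
lemma topCount_rev (f : Fin n → Bool) :
    (topCount (σ.trans Fin.revPerm) e (posCount fun j => !f j) : ℤ) =
      posCount e - topCount σ e (posCount f) := by
  have h1 := posCount_not f
  have h2 := card_filter_add_card_filter_not (s := ({h | e h = true} : Finset (Fin n)))
    (fun h => (σ h : ℕ) < posCount f)
  rw [filter_filter, filter_filter] at h2
  have h3 : topCount (σ.trans Fin.revPerm) e (posCount fun j => !f j) =
      #{h | e h = true ∧ ¬ (σ h : ℕ) < posCount f} := by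
    rw [topCount]
    congr 1
    ext h
    simp only [mem_filter, mem_univ, true_and, Equiv.trans_apply, Fin.revPerm_apply, Fin.val_rev]
    have := (σ h).2
    constructor <;> rintro ⟨h5, h6⟩ <;> exact ⟨h5, by omega⟩
  change _ = posCount e at h2
  rw [h3, topCount]
  omega

namespace Aligned

/-- The number of stable matchings and the rotation order of an aligned instance. -/
theorem numStable_and_equiv (H : I.Aligned σ τ e f) :
    ∃ N, N = (topCount σ e (posCount f) - topCount τ f (posCount e)) +
        (topCount τ f (posCount e) - topCount σ e (posCount f)) ∧
      I.numStable = N + 1 ∧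
      ∃ g : I.Rotation ≃ Fin N, ∀ R R', I.ExplicitlyPrecedes R R' ↔ g R < g R' := by
  rcases le_total (topCount σ e (posCount f)) (topCount τ f (posCount e)) with huv | huv
  · exact ⟨_, by omega, H.numStable_of_le huv, H.exists_equiv_of_le huv⟩
  -- Reversal replaces each end by its difference from `posCount e`, which exchanges their order and
  -- keeps their distance.
  · have h1 := topCount_rev (σ := σ) (e := e) f
    have h2 := topCount_not (τ := τ) (f := f) (posCount_le e)
    exact ⟨_, by omega, H.reverse.numStable_of_le (by omega),
      H.reverse.exists_equiv_of_le (by omega)⟩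

end Aligned

/-! ### Finite chains -/

/-- A relation pulled back from a strict order is already transitive. -/
lemma transGen_iff_lt {α β : Type*} [Preorder β] {r : α → α → Prop} {g : α → β}
    (hr : ∀ x y, r x y ↔ g x < g y) (x y : α) : Relation.TransGen r x y ↔ g x < g y := by
  constructor
  · intro h
    induction h with
    | single h => exact (hr _ _).1 h
    | tail _ h ih => exact ih.trans ((hr _ _).1 h)
  · exact fun h => .single ((hr _ _).2 h)

/-- A chain of `N` elements has `N + 1` downsets. -/
lemma card_downsets_of_equiv_fin {α : Type*} {N : ℕ} {r : α → α → Prop} (g : α ≃ Fin N)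
    (hr : ∀ x y, r x y ↔ g x < g y) :
    Nat.card {D : Set α // ∀ x ∈ D, ∀ y, r y x → y ∈ D} = N + 1 := by
  have hdown : ∀ k : Fin (N + 1), ∀ x ∈ {x | (g x : ℕ) < k}, ∀ y, r y x → y ∈ {x | (g x : ℕ) < k} :=
    fun k x hx y hyx => Set.mem_ofPred_eq ▸ lt_trans (Fin.lt_def.1 ((hr y x).1 hyx)) hx
  rw [← Nat.card_fin (N + 1)]
  refine (Nat.card_eq_of_bijective (fun k => ⟨_, hdown k⟩) ⟨?_, ?_⟩).symm
  · intro k k' hk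
    have hk' : ∀ x, (g x : ℕ) < k ↔ (g x : ℕ) < k' := fun x =>
      Set.ext_iff.1 (congrArg Subtype.val hk) x
    have h1 := fun (j : ℕ) (hj : j < N) => hk' (g.symm ⟨j, hj⟩)
    simp only [Equiv.apply_symm_apply] at h1
    have := k.2
    have := k'.2
    refine Fin.ext ?_
    rcases lt_trichotomy (k : ℕ) k' with hlt | heq | hlt
    · have := h1 k (by omega)
      omega
    · exact heq
    · have := h1 k' (by omega)
      omega
  · rintro ⟨D, hD⟩
    classical
    -- The least position missing from `D`, with `N` qualifying vacuously.
    have hex : ∃ m, ∀ h : m < N, g.symm ⟨m, h⟩ ∉ D := ⟨N, fun h => absurd h (lt_irrefl _)⟩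
    have hle : Nat.find hex ≤ N := Nat.find_min' hex fun h => absurd h (lt_irrefl _)
    refine ⟨⟨Nat.find hex, by omega⟩, Subtype.ext (Set.ext fun x => ?_)⟩
    change (g x : ℕ) < Nat.find hex ↔ x ∈ D
    constructor
    · intro hx
      have := Nat.find_min hex hx
      push Not at this
      obtain ⟨h, hmem⟩ := this
      simpa using hmem
    · intro hx
      by_contra hge
      have hlt : Nat.find hex < N := lt_of_le_of_lt (not_lt.1 hge) (g x).2
      refine Nat.find_spec hex hlt ?_
      rcases (not_lt.1 hge).lt_or_eq with h | h
      · exact hD x hx _ ((hr _ _).2 (by simpa [Fin.lt_def] using h))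
      · have : (⟨Nat.find hex, hlt⟩ : Fin N) = g x := Fin.ext h
        rwa [this, g.symm_apply_apply]

namespace Aligned

theorem rotation_poset (H : I.Aligned σ τ e f) :
    (∃ k : ℕ, Nonempty (I.Precedes ≃r ((· < ·) : Fin k → Fin k → Prop))) ∧
      I.numStable = Nat.card I.RotationDownset ∧ I.numStable = Nat.card I.Rotation + 1 := by
  obtain ⟨N, -, hN, g, hg⟩ := H.numStable_and_equiv
  have hp : ∀ R R', I.Precedes R R' ↔ g R < g R' := transGen_iff_lt hg
  refine ⟨⟨N, ⟨⟨g, fun {R R'} => (hp R R').symm⟩⟩⟩, ?_, ?_⟩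
  · rw [hN]
    exact (card_downsets_of_equiv_fin g hp).symm
  · rw [hN, Nat.card_congr g, Nat.card_fin]

end Aligned

/-! ### Instances in the one-attribute model are aligned -/

/-- By the sign of `x i * x i₀` each list is that of `i₀` or its reverse; with at least two entries,
the first entry tells which. -/
lemma symm_lt_symm_iff_of_mul {α : Type*} {n : ℕ} (p : α → Equiv.Perm (Fin (n + 1))) (i₀ : α)
    {x : α → ℝ} {y : Fin (n + 1) → ℝ}
    (h : ∀ i j l, (p i).symm j < (p i).symm l ↔ x i * y j > x i * y l) (i : α)
    (j l : Fin (n + 1)) :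
    (p i).symm j < (p i).symm l ↔
      if decide (p i 0 = p i₀ 0) = true then (p i₀).symm j < (p i₀).symm l
      else (p i₀).symm l < (p i₀).symm j := by
  rcases subsingleton_or_nontrivial (Fin (n + 1)) with hs | hs
  · simp [Subsingleton.elim j l]
  obtain ⟨j₀, l₀, hne⟩ := exists_pair_ne (Fin (n + 1))
  have hx : ∀ i, x i ≠ 0 := by
    intro i h0
    rcases lt_or_gt_of_ne ((p i).symm.injective.ne hne) with hlt | hlt <;>
      simp [h, h0] at hlt
  rcases (mul_ne_zero (hx i) (hx i₀)).lt_or_gt with hneg | hpos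
  · have hrev : ∀ j l, (p i).symm j < (p i).symm l ↔ (p i₀).symm l < (p i₀).symm j := by
      intro j l
      rw [h, h, gt_iff_lt, gt_iff_lt]
      rcases (hx i).lt_or_gt with h1 | h1
      · have h2 : 0 < x i₀ := by nlinarith
        rw [mul_lt_mul_left_of_neg h1, mul_lt_mul_iff_right₀ h2]
      · have h2 : x i₀ < 0 := by nlinarith
        rw [mul_lt_mul_left_of_neg h2, mul_lt_mul_iff_right₀ h1]
    have hdiff : p i 0 ≠ p i₀ 0 := by
      intro heq
      obtain ⟨m, hm⟩ := exists_ne (0 : Fin (n + 1))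
      have h1 : (p i).symm (p i 0) < (p i).symm (p i m) := by
        simpa using Fin.pos_of_ne_zero hm
      rw [hrev, heq, (p i₀).symm_apply_apply] at h1
      exact absurd h1 (Fin.not_lt_zero _)
    simpa [hdiff] using hrev j l
  · have hsame : ∀ j l, (p i).symm j < (p i).symm l ↔ (p i₀).symm j < (p i₀).symm l := by
      intro j l
      rw [h, h, gt_iff_lt, gt_iff_lt]
      rcases (hx i).lt_or_gt with h1 | h1
      · have h2 : x i₀ < 0 := by nlinarith
        rw [mul_lt_mul_left_of_neg h1, mul_lt_mul_left_of_neg h2]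
      · have h2 : 0 < x i₀ := by nlinarith
        rw [mul_lt_mul_iff_right₀ h1, mul_lt_mul_iff_right₀ h2]
    have heq : p i 0 = p i₀ 0 := by
      by_contra hdiff
      have h1 : (p i).symm (p i 0) < (p i).symm (p i₀ 0) := by
        rw [(p i).symm_apply_apply]
        refine Fin.pos_of_ne_zero fun h0 => hdiff ?_
        rw [← (p i).apply_symm_apply (p i₀ 0), h0]
      rw [hsame, (p i₀).symm_apply_apply] at h1
      exact absurd h1 (Fin.not_lt_zero _)
    simpa [heq] using hsame j l

/-- The type of a man or woman: whether the first entry of the list agrees with that of the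
first man or woman. -/
def sameFirst {n : ℕ} (p : Fin (n + 1) → Equiv.Perm (Fin (n + 1))) (i : Fin (n + 1)) : Bool :=
  decide (p i 0 = p 0 0)

theorem IsAttribute.aligned {n : ℕ} {I : SMInstance (n + 1)} (h : I.IsAttribute 1) :
    I.Aligned (I.women 0).symm (I.men 0).symm (sameFirst I.men) (sameFirst I.women) := by
  obtain ⟨mf, mp, wf, wp, h1, h2⟩ := h
  exact ⟨fun i j l => symm_lt_symm_iff_of_mul I.men 0 (x := fun i => mf i 0) (y := fun j => wp j 0)
      (fun i j l => by simpa [ManPrefers, dotProduct] using h1 i j l) i j l,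
    fun j i h => symm_lt_symm_iff_of_mul I.women 0 (x := fun j => wf j 0) (y := fun i => mp i 0)
      (fun j i h => by simpa [WomanPrefers, dotProduct] using h2 j i h) j i h⟩

lemma aligned_of_zero (I : SMInstance 0) :
    I.Aligned 1 1 (fun _ => true) (fun _ => true) :=
  ⟨fun i => i.elim0, fun i => i.elim0⟩

theorem IsAttribute.rotation_poset (h : I.IsAttribute 1) :
    (∃ k : ℕ, Nonempty (I.Precedes ≃r ((· < ·) : Fin k → Fin k → Prop))) ∧
      I.numStable = Nat.card I.RotationDownset ∧ I.numStable = Nat.card I.Rotation + 1 := by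
  cases n with
  | zero => exact (aligned_of_zero I).rotation_poset
  | succ n => exact h.aligned.rotation_poset

end SMInstance

/-! ### Structured programs for random access machines -/

namespace RAM

/-- The contents of the registers and the unread input. -/
abbrev Store : Type := (ℕ → ℕ) × List ℕ

/-- The effect of an instruction, other than a jump, on the store. -/
def Instr.eff (s : Store) (a : Instr) : Store :=
  ((a.exec ⟨0, s.1, s.2⟩).reg, (a.exec ⟨0, s.1, s.2⟩).input)

/-- The instruction is not a jump. -/
def Instr.IsBasic : Instr → Prop
  | .jump _ _ => False
  | _ => True

lemma Instr.IsBasic.exec_eq {a : Instr} (ha : a.IsBasic) (pc : ℕ) (s : Store) :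
    a.exec ⟨pc, s.1, s.2⟩ = ⟨pc + 1, (a.eff s).1, (a.eff s).2⟩ := by
  cases a <;> first | rfl | exact ha.elim

/-- A piece of a program: a sequence of instructions without jumps, or a loop which repeats such
a sequence as long as register `j` is positive (register `1` has to be positive). -/
inductive Segment : Type
  | block (L : List Instr)
  | loop (j : ℕ) (L : List Instr)

/-- The instructions of a segment which starts at number `o`. -/
def Segment.code (o : ℕ) : Segment → List Instr
  | .block L => L
  | .loop j L => .jump (o + 1 + L.length) 1 :: (L ++ [.jump (o + 1) j])

/-- The program with the given segments, starting at number `o`. -/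
def assemble : ℕ → List Segment → List Instr
  | _, [] => []
  | o, S :: rest => S.code o ++ assemble (o + (S.code o).length) rest

/-- Started in the store `s`, the program with the given segments reaches its end after at most
`T` steps, with a store that satisfies `Q`. -/
def Terminates (segs : List Segment) (T : ℕ) (Q : Store → Prop) (s : Store) : Prop :=
  -- Jump targets are absolute, so all prefixes `pre` are covered to let segments compose.
  ∃ s' t, t ≤ T ∧ Q s' ∧ ∀ pre : List Instr,
    (step (pre ++ assemble pre.length segs))^[t] ⟨pre.length, s.1, s.2⟩ =
      ⟨(pre ++ assemble pre.length segs).length, s'.1, s'.2⟩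

lemma step_of_getElem? {P : List Instr} {c : Config} {a : Instr} (h : P[c.pc]? = some a) :
    step P c = a.exec c := by
  simp [step, h]

lemma iterate_step_block {L : List Instr} (hL : ∀ a ∈ L, a.IsBasic) (pre post : List Instr)
    (s : Store) :
    (step (pre ++ (L ++ post)))^[L.length] ⟨pre.length, s.1, s.2⟩ =
      ⟨pre.length + L.length, (L.foldl Instr.eff s).1, (L.foldl Instr.eff s).2⟩ := by
  induction L generalizing pre s with
  | nil => rfl
  | cons a L ih =>
    rw [List.length_cons, Function.iterate_succ_apply, List.foldl_cons]
    have h := ih (fun b hb => hL b (List.mem_cons_of_mem _ hb)) (pre ++ [a]) (a.eff s)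
    rw [List.append_assoc] at h
    rw [step_of_getElem? (a := a) (by simp), (hL a List.mem_cons_self).exec_eq]
    simp only [List.length_append, List.length_cons, List.length_nil, List.cons_append,
      List.nil_append] at h ⊢
    rw [h]
    congr 1
    omega

lemma Terminates.nil {T : ℕ} {Q : Store → Prop} {s : Store} (h : Q s) : Terminates [] T Q s :=
  ⟨s, 0, T.zero_le, h, fun pre => by simp [assemble]⟩

lemma Terminates.mono {segs : List Segment} {T T' : ℕ} {Q : Store → Prop} {s : Store}
    (h : Terminates segs T Q s) (hT : T ≤ T') : Terminates segs T' Q s := by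
  obtain ⟨s', t, ht, hQ, hs⟩ := h
  exact ⟨s', t, ht.trans hT, hQ, hs⟩

lemma Terminates.block {L : List Instr} (hL : ∀ a ∈ L, a.IsBasic) {rest : List Segment} {T : ℕ}
    {Q : Store → Prop} {s : Store} (h : Terminates rest T Q (L.foldl Instr.eff s)) :
    Terminates (.block L :: rest) (L.length + T) Q s := by
  obtain ⟨s', t, ht, hQ, hs⟩ := h
  refine ⟨s', t + L.length, by omega, hQ, fun pre => ?_⟩
  have h := hs (pre ++ L)
  rw [List.append_assoc, List.length_append] at h
  rw [Function.iterate_add_apply]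
  simp only [assemble, Segment.code]
  rw [iterate_step_block hL, h]

/-- Control enters at the closing jump, which is the test; the extra step is the test that fails. -/
lemma iterate_step_loop {L : List Instr} (hL : ∀ a ∈ L, a.IsBasic) {j : ℕ} {Inv : ℕ → Store → Prop}
    (hj : ∀ k s, Inv k s → s.1 j = k)
    (hstep : ∀ k s, Inv (k + 1) s → Inv k (L.foldl Instr.eff s)) (k : ℕ) (s : Store)
    (hs : Inv k s) :
    ∃ s', Inv 0 s' ∧ ∀ pre post : List Instr,
      (step (pre ++ (L ++ .jump pre.length j :: post)))^[k * (L.length + 1) + 1]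
        ⟨pre.length + L.length, s.1, s.2⟩ = ⟨pre.length + L.length + 1, s'.1, s'.2⟩ := by
  induction k generalizing s with
  | zero =>
    refine ⟨s, hs, fun pre post => ?_⟩
    rw [Nat.zero_mul, Nat.zero_add, Function.iterate_one,
      step_of_getElem? (a := .jump pre.length j) (by simp)]
    simp [Instr.exec, hj _ _ hs]
  | succ k ih =>
    obtain ⟨s', h0, h⟩ := ih _ (hstep k s hs)
    refine ⟨s', h0, fun pre post => ?_⟩
    have hsplit : (k + 1) * (L.length + 1) + 1 = (k * (L.length + 1) + 1) + L.length + 1 := by ring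
    rw [hsplit, Function.iterate_succ_apply, step_of_getElem? (a := .jump pre.length j) (by simp)]
    simp only [Instr.exec, hj _ _ hs, Nat.succ_pos, if_true]
    rw [Function.iterate_add_apply, iterate_step_block hL, h]

lemma Terminates.loop {L : List Instr} (hL : ∀ a ∈ L, a.IsBasic) {j : ℕ} {rest : List Segment}
    {T : ℕ} {Q : Store → Prop} (Inv : ℕ → Store → Prop) {k : ℕ} {s : Store} (hs : Inv k s)
    (h1 : 0 < s.1 1) (hj : ∀ k s, Inv k s → s.1 j = k)
    (hstep : ∀ k s, Inv (k + 1) s → Inv k (L.foldl Instr.eff s))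
    (h : ∀ s', Inv 0 s' → Terminates rest T Q s') :
    Terminates (.loop j L :: rest) (k * (L.length + 1) + 2 + T) Q s := by
  obtain ⟨s₁, hs₁, hloop⟩ := iterate_step_loop hL hj hstep k s hs
  obtain ⟨s', t, ht, hQ, hrest⟩ := h s₁ hs₁
  refine ⟨s', t + (k * (L.length + 1) + 1) + 1, by omega, hQ, fun pre => ?_⟩
  have e1 := hloop (pre ++ [.jump (pre.length + 1 + L.length) 1])
    (assemble (pre.length + (L.length + 1 + 1)) rest)
  have e2 := hrest (pre ++ .jump (pre.length + 1 + L.length) 1 ::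
    (L ++ [.jump (pre.length + 1) j]))
  simp only [List.append_assoc, List.length_append, List.length_cons, List.length_nil,
    List.cons_append, List.nil_append, Nat.zero_add] at e1 e2
  simp only [assemble, Segment.code, List.append_assoc, List.length_append, List.length_cons,
    List.length_nil, List.cons_append, List.nil_append, Nat.zero_add]
  rw [Function.iterate_succ_apply,
    step_of_getElem? (a := .jump (pre.length + 1 + L.length) 1) (by simp)]
  simp only [Instr.exec, h1, if_true]
  rw [Function.iterate_add_apply, e1, ← e2]
  congr 2
  omega

lemma Terminates.outputs {segs : List Segment} {T y : ℕ} {x : List ℕ}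
    (h : Terminates segs T (fun s => s.1 0 = y) (fun _ => 0, x)) :
    Outputs (assemble 0 segs) x y T := by
  obtain ⟨s', t, ht, hy, hs⟩ := h
  have := hs []
  simp only [List.nil_append, List.length_nil] at this
  exact ⟨t, ht, by rw [start, this], by rw [start, this]; exact hy⟩

end RAM

/-! ### A program that counts the stable matchings -/

namespace RAM

/-- Put into register `out` the number of the `k` less than the content of register `len` such that
`X (X (X list + k) + X sgn) = X (X sgn)`. -/
def countSegments (list sgn len out : ℕ) : List Segment :=
  [.block [.add 8 list 0, .load 10 sgn, .add 3 len 0, .const out 0],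
    -- The two truncated differences add up to the distance of the values, and `1 - distance` is the
    -- indicator of equality.
    .loop 3 [.load 6 8, .add 6 6 sgn, .load 6 6, .sub 12 6 10, .sub 13 10 6, .add 12 12 13,
      .sub 12 1 12, .add out out 12, .add 8 8 1, .sub 3 3 1]]

/-- Read the input, which starts with `n`, and write the following `2 * n ^ 2` numbers into the
registers from number `32` on. Next to them write the first entries of the `2 * n` lists. -/
def readSegments : List Segment :=
  -- Registers 0 and 1 serve as the constants 0 and 1 until the output is written. The loop that
  -- follows squares `n` by repeated addition.
  [.block [.const 1 1, .read 2, .add 3 2 0],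
    .loop 3 [.add 4 4 2, .sub 3 3 1],
    .block [.const 14 32, .add 15 14 4, .add 4 4 4, .add 3 4 0, .add 5 14 0],
    .loop 3 [.read 6, .store 5 6, .add 5 5 1, .sub 3 3 1],
    .block [.add 16 5 0, .add 17 16 2, .add 8 14 0, .add 9 16 0, .add 3 2 2],
    .loop 3 [.load 6 8, .store 9 6, .add 8 8 2, .add 9 9 1, .sub 3 3 1]]

/-- The program that counts the stable matchings of an instance in the one-attribute model. -/
def stableCounter : List Segment :=
  -- Registers 18 and 19 receive p and q, then 20 and 21 receive v and u.
  readSegments ++ (countSegments 15 16 2 18 ++ (countSegments 14 17 2 19 ++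
    (countSegments 14 17 18 20 ++ (countSegments 15 16 19 21 ++
      [.block [.sub 12 20 21, .sub 13 21 20, .add 12 12 13, .add 0 12 1]]))))

/-- The conditions on register numbers and addresses keep the data clear of the scratch registers. A
pass costs 11 steps: ten instructions and the jump. -/
lemma Terminates.count {list sgn len out : ℕ} {rest : List Segment} {T : ℕ} {Q : Store → Prop}
    {s : Store} {m c : ℕ} (hout : 14 ≤ out ∧ out < 32)
    (hsgn : 14 ≤ sgn ∧ sgn ≠ out) (hlen : 2 = len ∨ 14 ≤ len)
    (h0 : s.1 0 = 0) (h1 : s.1 1 = 1) (hs32 : 32 ≤ s.1 sgn) (hl32 : 32 ≤ s.1 list)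
    (hm : s.1 len = m)
    (hc : Nat.count (fun k => s.1 (s.1 (s.1 list + k) + s.1 sgn) = s.1 (s.1 sgn)) m = c)
    (h : ∀ s' : Store, (∀ i, i ∉ [3, 6, 8, 10, 12, 13, out] → s'.1 i = s.1 i) →
      s'.1 out = c → Terminates rest T Q s') :
    Terminates (countSegments list sgn len out ++ rest) (4 + (m * 11 + 2 + T)) Q s := by
  subst hm hc
  obtain ⟨r, x⟩ := s
  simp only at h0 h1 hs32 hl32 h ⊢
  refine Terminates.block (by simp [Instr.IsBasic]) ?_
  set P := fun k => r (r (r list + k) + r sgn) = r (r sgn) with hP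
  refine Terminates.loop (k := r len) (by simp [Instr.IsBasic])
    (fun k s => k ≤ r len ∧ s.1 3 = k ∧ s.1 8 = r list + (r len - k) ∧ s.1 10 = r (r sgn) ∧
      s.1 out = Nat.count P (r len - k) ∧ ∀ i, i ∉ [3, 6, 8, 10, 12, 13, out] → s.1 i = r i)
    ?_ ?_ (fun k s hs => hs.2.1) ?_ fun s hs => h s hs.2.2.2.2.2 (by simpa using hs.2.2.2.2.1)
  · have e1 : 3 ≠ out := by omega
    have e2 : 8 ≠ out := by omega
    have e3 : 10 ≠ out := by omega
    have e4 : len ≠ 8 := by omega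
    have e5 : len ≠ 10 := by omega
    have e6 : sgn ≠ 8 := by omega
    have e7 : r sgn ≠ 8 := by omega
    simp [Instr.eff, Instr.exec, Config.write, Function.update_apply, e1, e2, e3, e4, e5, e6, e7,
      h0]
    intro i hi3 _ hi8 hi10 _ _ hio
    simp [hi3, hi8, hi10, hio]
  · have e1 : 1 ≠ out := by omega
    simp [Instr.eff, Instr.exec, Config.write, Function.update_apply, e1, h1]
  · rintro k ⟨r', x'⟩ ⟨hk, h3, h8, h10, hcnt, hframe⟩
    simp only at h3 h8 h10 hcnt hframe
    have f1 : r' 1 = 1 := by rw [hframe 1 (by simp; omega), h1]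
    have fsgn : r' sgn = r sgn := hframe _ (by simp; omega)
    have flist : r' (r' 8) = r (r list + (r len - (k + 1))) := by
      rw [h8]
      exact hframe _ (by simp; omega)
    have fval : r' (r' (r' 8) + r' sgn) =
        r (r (r list + (r len - (k + 1))) + r sgn) := by
      rw [flist, fsgn]
      exact hframe _ (by simp; omega)
    have hsub : r len - k = (r len - (k + 1)) + 1 := by omega
    have e1 : 3 ≠ out := by omega
    have e2 : 8 ≠ out := by omega
    have e3 : 10 ≠ out := by omega
    have e4 : out ≠ 6 := by omega
    have e5 : out ≠ 12 := by omega
    have e6 : out ≠ 13 := by omega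
    have e7 : sgn ≠ 6 := by omega
    have e8 : out ≠ 8 := by omega
    have e9 : out ≠ 3 := by omega
    have e10 : 1 ≠ out := by omega
    have e11 : r' (r list + (r len - (k + 1))) + r' sgn ≠ 6 := by omega
    rw [hsub, Nat.count_succ]
    simp only [List.foldl_cons, List.foldl_nil, Instr.eff, Instr.exec, Config.write,
      Function.update_apply, e1, e2, e3, e4, e5, e6, e7, e8, e9, e10, e11, f1, h3, h8, h10, hcnt,
      if_true, if_false, Nat.reduceEqDiff, OfNat.one_ne_ofNat]
    refine ⟨by omega, by omega, by omega, trivial, ?_, ?_⟩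
    · rw [h8] at fval
      have hPm : P (r len - (k + 1)) ↔
          r (r (r list + (r len - (k + 1))) + r sgn) = r (r sgn) := Iff.rfl
      rw [fval]
      split_ifs with hm <;> rw [hPm] at hm <;> omega
    · intro i hi
      simp only [List.mem_cons, List.not_mem_nil, or_false, not_or] at hi
      simp only [hi, if_false]
      exact hframe i (by simp [hi])

/-- The registers after the input has been read. -/
structure Loaded (n : ℕ) (G : ℕ → ℕ) (r : ℕ → ℕ) : Prop where
  zero : r 0 = 0
  one : r 1 = 1
  two : r 2 = n
  menList : r 14 = 32
  womenList : r 15 = 32 + n * n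
  menFirst : r 16 = 32 + (n * n + n * n)
  womenFirst : r 17 = 32 + (n * n + n * n) + n
  entry : ∀ i < n * n + n * n, r (32 + i) = G i
  first : ∀ k < n + n, r (32 + (n * n + n * n) + k) = G (k * n)

lemma Loaded.congr {n : ℕ} {G r r' : ℕ → ℕ} (h : Loaded n G r) {out : ℕ}
    (hout : 18 ≤ out ∧ out < 32) (hr : ∀ i, i ∉ [3, 6, 8, 10, 12, 13, out] → r' i = r i) :
    Loaded n G r' where
  zero := by rw [hr 0 (by simp; omega), h.zero]
  one := by rw [hr 1 (by simp; omega), h.one]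
  two := by rw [hr 2 (by simp; omega), h.two]
  menList := by rw [hr 14 (by simp; omega), h.menList]
  womenList := by rw [hr 15 (by simp; omega), h.womenList]
  menFirst := by rw [hr 16 (by simp; omega), h.menFirst]
  womenFirst := by rw [hr 17 (by simp; omega), h.womenFirst]
  entry i hi := by rw [hr _ (by simp; omega), h.entry i hi]
  first k hk := by rw [hr _ (by simp; omega), h.first k hk]

/-- The three loops square `n`, store the lists and copy their first entries; each pass costs one
step more than its body. -/
lemma Terminates.read {n : ℕ} {D : List ℕ} {rest : List Segment} {T : ℕ} {Q : Store → Prop}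
    (h : ∀ s : Store, Loaded n (fun i => D.getD i 0) s.1 → Terminates rest T Q s) :
    Terminates (readSegments ++ rest)
      (3 + (n * 3 + 2 + (5 + ((n * n + n * n) * 5 + 2 + (5 + ((n + n) * 6 + 2 + T))))))
      Q (fun _ => 0, n :: D) := by
  refine Terminates.block (by simp [Instr.IsBasic]) ?_
  refine Terminates.loop (k := n) (by simp [Instr.IsBasic])
    (fun k s => k ≤ n ∧ s.1 3 = k ∧ s.1 0 = 0 ∧ s.1 1 = 1 ∧ s.1 2 = n ∧ s.1 4 = (n - k) * n ∧
      s.2 = D) ?_ ?_ (fun k s hs => hs.2.1) ?_ ?_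
  · simp [Instr.eff, Instr.exec, Config.write]
  · simp [Instr.eff, Instr.exec, Config.write]
  · rintro k ⟨r, x⟩ ⟨hk, h3, h0, h1, h2, h4, hx⟩
    simp only at h3 h0 h1 h2 h4 hx
    have hsub : n - k = (n - (k + 1)) + 1 := by omega
    simp [Instr.eff, Instr.exec, Config.write, h3, h0, h1, h2, h4, hx]
    refine ⟨by omega, ?_⟩
    rw [hsub]
    ring
  rintro ⟨r, x⟩ ⟨-, h3, h0, h1, h2, h4, hx⟩
  simp only at h3 h0 h1 h2 h4 hx
  refine Terminates.block (by simp [Instr.IsBasic]) ?_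
  set N := n * n + n * n with hN
  refine Terminates.loop (k := N) (by simp [Instr.IsBasic])
    (fun k s => k ≤ N ∧ s.1 3 = k ∧ s.1 0 = 0 ∧ s.1 1 = 1 ∧ s.1 2 = n ∧ s.1 14 = 32 ∧
      s.1 15 = 32 + n * n ∧ s.1 5 = 32 + (N - k) ∧ s.2 = D.drop (N - k) ∧
      ∀ i < N - k, s.1 (32 + i) = D.getD i 0) ?_ ?_ (fun k s hs => hs.2.1) ?_ ?_
  · simp [Instr.eff, Instr.exec, Config.write, Function.update_apply, h0, h1, h2, h4, hx, hN]
  · simp [Instr.eff, Instr.exec, Config.write, h1]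
  · clear h3 h0 h1 h2 h4 hx
    rintro k ⟨r, x⟩ ⟨hk, h3, h0, h1, h2, h14, h15, h5, hx, hmem⟩
    simp only at h3 h0 h1 h2 h14 h15 h5 hx hmem
    have hsub : N - k = (N - (k + 1)) + 1 := by omega
    have a0 : 0 ≠ 32 + (N - (k + 1)) := by omega
    have a1 : 1 ≠ 32 + (N - (k + 1)) := by omega
    have a2 : 2 ≠ 32 + (N - (k + 1)) := by omega
    have a3 : 3 ≠ 32 + (N - (k + 1)) := by omega
    have a5 : 5 ≠ 32 + (N - (k + 1)) := by omega
    have a14 : 14 ≠ 32 + (N - (k + 1)) := by omega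
    have a15 : 15 ≠ 32 + (N - (k + 1)) := by omega
    rw [hsub]
    generalize N - (k + 1) = m at *
    -- An exhausted input reads as `0`, in accordance with the default of `getD`.
    have hhead : (D.drop m).headD 0 = D.getD m 0 := by
      rw [List.headD_eq_head?_getD, List.head?_drop, List.getD_eq_getElem?_getD]
    simp only [List.foldl_cons, List.foldl_nil, Instr.eff, Instr.exec, Config.write,
      Function.update_apply, h3, h0, h1, h2, h14, h15, h5, hx, a0, a1, a2, a3, a5, a14, a15,
      if_true, if_false, Nat.reduceEqDiff, OfNat.one_ne_ofNat, OfNat.zero_ne_ofNat, hhead,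
      List.tail_drop]
    refine ⟨by omega, by omega, trivial, trivial, trivial, trivial, trivial, by omega, trivial, ?_⟩
    intro i hi
    have b3 : 32 + i ≠ 3 := by omega
    have b5 : 32 + i ≠ 5 := by omega
    have b6 : 32 + i ≠ 6 := by omega
    simp only [b3, b5, b6, if_false, Nat.add_left_cancel_iff]
    split_ifs with him
    · rw [him]
    · exact hmem i (by omega)
  clear h3 h0 h1 h2 h4 hx
  rintro ⟨r, x⟩ ⟨-, h3, h0, h1, h2, h14, h15, h5, -, hmem⟩
  simp only [Nat.sub_zero] at h3 h0 h1 h2 h14 h15 h5 hmem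
  refine Terminates.block (by simp [Instr.IsBasic]) ?_
  refine Terminates.loop (k := n + n) (by simp [Instr.IsBasic])
    (fun k s => k ≤ n + n ∧ s.1 3 = k ∧ s.1 0 = 0 ∧ s.1 1 = 1 ∧ s.1 2 = n ∧ s.1 14 = 32 ∧
      s.1 15 = 32 + n * n ∧ s.1 16 = 32 + N ∧ s.1 17 = 32 + N + n ∧
      s.1 8 = 32 + (n + n - k) * n ∧ s.1 9 = 32 + N + (n + n - k) ∧
      (∀ i < N, s.1 (32 + i) = D.getD i 0) ∧
      ∀ i < n + n - k, s.1 (32 + N + i) = D.getD (i * n) 0) ?_ ?_ (fun k s hs => hs.2.1) ?_ ?_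
  · simp [Instr.eff, Instr.exec, Config.write, Function.update_apply, h0, h1, h2, h14, h15, h5]
    intro i hi
    have b3 : 32 + i ≠ 3 := by omega
    have b8 : 32 + i ≠ 8 := by omega
    have b9 : 32 + i ≠ 9 := by omega
    have b16 : 32 + i ≠ 16 := by omega
    have b17 : 32 + i ≠ 17 := by omega
    simpa [b3, b8, b9, b16, b17] using hmem i hi
  · simp [Instr.eff, Instr.exec, Config.write, h1]
  · clear h3 h0 h1 h2 h14 h15 h5 hmem
    rintro k ⟨r, x⟩ ⟨hk, h3, h0, h1, h2, h14, h15, h16, h17, h8, h9, hmem, hfirst⟩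
    simp only at h3 h0 h1 h2 h14 h15 h16 h17 h8 h9 hmem hfirst
    have hsub : n + n - k = (n + n - (k + 1)) + 1 := by omega
    have hm : n + n - (k + 1) + 1 ≤ n + n := by omega
    rw [hsub]
    generalize n + n - (k + 1) = m at *
    have hmn : m * n < N := by
      have : (m + 1) * n ≤ (n + n) * n := Nat.mul_le_mul_right n hm
      have h4 : (m + 1) * n = m * n + n := by ring
      have h5 : (n + n) * n = N := by rw [hN]; ring
      omega
    have hval : r (32 + m * n) = D.getD (m * n) 0 := hmem _ hmn
    have b6 : 32 + m * n ≠ 6 := by omega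
    have a0 : 0 ≠ 32 + N + m := by omega
    have a1 : 1 ≠ 32 + N + m := by omega
    have a2 : 2 ≠ 32 + N + m := by omega
    have a3 : 3 ≠ 32 + N + m := by omega
    have a8 : 8 ≠ 32 + N + m := by omega
    have a9 : 9 ≠ 32 + N + m := by omega
    have a14 : 14 ≠ 32 + N + m := by omega
    have a15 : 15 ≠ 32 + N + m := by omega
    have a16 : 16 ≠ 32 + N + m := by omega
    have a17 : 17 ≠ 32 + N + m := by omega
    simp only [List.foldl_cons, List.foldl_nil, Instr.eff, Instr.exec, Config.write,
      Function.update_apply, h3, h0, h1, h2, h14, h15, h16, h17, h8, h9, a0, a1, a2, a3, a8, a9,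
      a14, a15, a16, a17, hval,
      if_true, if_false, Nat.reduceEqDiff, OfNat.one_ne_ofNat, OfNat.zero_ne_ofNat]
    refine ⟨by omega, by omega, trivial, trivial, trivial, trivial, trivial, trivial, trivial,
      by ring, by omega, ?_, ?_⟩
    · intro i hi
      have c3 : 32 + i ≠ 3 := by omega
      have c8 : 32 + i ≠ 8 := by omega
      have c9 : 32 + i ≠ 9 := by omega
      have c6 : 32 + i ≠ 6 := by omega
      have cN : 32 + i ≠ 32 + N + m := by omega
      simpa only [c3, c8, c9, c6, cN, if_false] using hmem i hi
    · intro i hi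
      have c3 : 32 + N + i ≠ 3 := by omega
      have c8 : 32 + N + i ≠ 8 := by omega
      have c9 : 32 + N + i ≠ 9 := by omega
      have c6 : 32 + N + i ≠ 6 := by omega
      simp only [c3, c8, c9, c6, if_false, Nat.add_left_cancel_iff]
      split_ifs with him
      · rw [him]
      · exact hfirst i (by omega)
  rintro s ⟨-, h3, h0, h1, h2, h14, h15, h16, h17, -, -, hmem, hfirst⟩
  exact h s ⟨h0, h1, h2, h14, h15, h16, h17, hmem, hfirst⟩

/-- Entry `i` of the lists, the lists of the men being followed by those of the women, is `G i`.
How many of the first `m` men on the list of the first woman have the same first choice as the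
first man? -/
def countMen (n : ℕ) (G : ℕ → ℕ) (m : ℕ) : ℕ :=
  Nat.count (fun k => G (G (n * n + k) * n) = G 0) m

/-- How many of the first `m` women on the list of the first man have the same first choice as the
first woman? -/
def countWomen (n : ℕ) (G : ℕ → ℕ) (m : ℕ) : ℕ :=
  Nat.count (fun k => G ((n + G k) * n) = G (n * n)) m

lemma count_congr {p q : ℕ → Prop} [DecidablePred p] [DecidablePred q] {m : ℕ}
    (h : ∀ k < m, p k ↔ q k) : Nat.count p m = Nat.count q m := by
  rw [Nat.count_eq_card_filter_range, Nat.count_eq_card_filter_range]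
  exact congrArg _ (Finset.filter_congr fun k hk => h k (Finset.mem_range.1 hk))

/-- The bound `hG` keeps every lookup inside the men's half of the table of first entries. -/
lemma Loaded.count_men {n : ℕ} {G r : ℕ → ℕ} (h : Loaded n G r)
    (hG : ∀ k < n, G (n * n + k) < n) {m : ℕ} (hm : m ≤ n) :
    Nat.count (fun k => r (r (r 15 + k) + r 16) = r (r 16)) m = countMen n G m := by
  refine count_congr fun k hk => ?_
  have hn : k < n := by omega
  have hnn : n ≤ n * n := Nat.le_mul_of_pos_left n (by omega)
  have e1 : r (r 15 + k) = G (n * n + k) := by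
    rw [h.womenList, add_assoc, h.entry _ (by omega)]
  have e2 : r (r 16) = G 0 := by
    have := h.first 0 (by omega)
    rwa [add_zero, ← h.menFirst, zero_mul] at this
  rw [e1, e2, h.menFirst, add_comm, h.first _ (by have := hG k hn; omega)]

lemma Loaded.count_women {n : ℕ} {G r : ℕ → ℕ} (h : Loaded n G r)
    (hG : ∀ k < n, G k < n) {m : ℕ} (hm : m ≤ n) :
    Nat.count (fun k => r (r (r 14 + k) + r 17) = r (r 17)) m = countWomen n G m := by
  refine count_congr fun k hk => ?_
  have hn : k < n := by omega
  have hnn : n ≤ n * n := Nat.le_mul_of_pos_left n (by omega)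
  have e1 : r (r 14 + k) = G k := by
    rw [h.menList, h.entry _ (by omega)]
  have e2 : r (r 17) = G (n * n) := by
    have := h.first n (by omega)
    rwa [← h.womenFirst] at this
  rw [e1, e2, h.womenFirst, add_comm, add_assoc, h.first _ (by have := hG k hn; omega)]

theorem terminates_stableCounter {n : ℕ} {D : List ℕ} {G : ℕ → ℕ} (hD : ∀ i, D.getD i 0 = G i)
    (hG : ∀ k < n, G k < n ∧ G (n * n + k) < n) :
    Terminates stableCounter (100 * (n * n + n * n + 1) + 100)
      (fun s => s.1 0 = (countWomen n G (countMen n G n) - countMen n G (countWomen n G n)) +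
        (countMen n G (countWomen n G n) - countWomen n G (countMen n G n)) + 1)
      (fun _ => 0, n :: D) := by
  have hG1 : ∀ k < n, G (n * n + k) < n := fun k hk => (hG k hk).2
  have hG2 : ∀ k < n, G k < n := fun k hk => (hG k hk).1
  have hp : countMen n G n ≤ n := Nat.count_le _
  have hq : countWomen n G n ≤ n := Nat.count_le _
  have hDG : (fun i => D.getD i 0) = G := funext hD
  have hmono : ∀ {T : ℕ} {segs : List Segment} {Q s}, Terminates segs T Q s →
      T ≤ 100 * (n * n + n * n + 1) + 100 →
      Terminates segs (100 * (n * n + n * n + 1) + 100) Q s := fun h hT => h.mono hT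
  have hnn : n ≤ n * n := by
    rcases Nat.eq_zero_or_pos n with rfl | h0
    · simp
    · exact Nat.le_mul_of_pos_left n h0
  refine hmono (T := 3 + (n * 3 + 2 + (5 + ((n * n + n * n) * 5 + 2 + (5 + ((n + n) * 6 + 2 +
    (4 + (n * 11 + 2 + (4 + (n * 11 + 2 + (4 + (countMen n G n * 11 + 2 +
      (4 + (countWomen n G n * 11 + 2 + (4 + 0)))))))))))))))
    (Terminates.read fun s hs => ?_) (by omega)
  rw [hDG] at hs
  refine Terminates.count (by omega) (by omega) (by omega) hs.zero hs.one
    (by rw [hs.menFirst]; omega) (by rw [hs.womenList]; omega) hs.two (hs.count_men hG1 le_rfl)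
    fun s₁ hf₁ h18 => ?_
  have hs₁ := hs.congr (by omega) hf₁
  refine Terminates.count (by omega) (by omega) (by omega) hs₁.zero hs₁.one
    (by rw [hs₁.womenFirst]; omega) (by rw [hs₁.menList]) hs₁.two (hs₁.count_women hG2 le_rfl)
    fun s₂ hf₂ h19 => ?_
  have hs₂ := hs₁.congr (by omega) hf₂
  replace h18 := (hf₂ 18 (by simp)).trans h18
  refine Terminates.count (by omega) (by omega) (by omega) hs₂.zero hs₂.one
    (by rw [hs₂.womenFirst]; omega) (by rw [hs₂.menList]) h18 (hs₂.count_women hG2 hp)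
    fun s₃ hf₃ h20 => ?_
  have hs₃ := hs₂.congr (by omega) hf₃
  replace h19 := (hf₃ 19 (by simp)).trans h19
  refine Terminates.count (by omega) (by omega) (by omega) hs₃.zero hs₃.one
    (by rw [hs₃.menFirst]; omega) (by rw [hs₃.womenList]; omega) h19 (hs₃.count_men hG1 hq)
    fun s₄ hf₄ h21 => ?_
  have hs₄ := hs₃.congr (by omega) hf₄
  replace h20 := (hf₄ 20 (by simp)).trans h20
  refine Terminates.block (by simp [Instr.IsBasic]) (Terminates.nil ?_)
  have h1 := hs₄.one
  simp [Instr.eff, Instr.exec, Config.write, h20, h21, h1]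

end RAM

/-! ### The program on the encodings of instances -/

lemma List.length_flatten_ofFn_ofFn {α : Type*} {m n : ℕ} (F : Fin m → Fin n → α) :
    (List.ofFn fun i => List.ofFn fun r => F i r).flatten.length = m * n := by
  simp [List.length_flatten, List.map_ofFn, Function.comp_def]

lemma List.flatten_ofFn_ofFn {α : Type*} {m n : ℕ} (F : Fin m → Fin n → α) :
    (List.ofFn fun i => List.ofFn fun r => F i r).flatten =
      List.ofFn fun x : Fin (m * n) => F x.divNat x.modNat := by
  rw [List.ofFn_mul]
  congr 2
  funext i
  congr 1
  funext r
  have hn : 0 < n := Fin.pos r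
  congr 1
  · ext
    simp [Fin.divNat, Nat.add_div_of_dvd_right, mul_comm, hn]
  · ext
    simp [Fin.modNat, Nat.mod_eq_of_lt]

lemma List.getD_flatten_ofFn_ofFn {α : Type*} {m n : ℕ} (F : Fin m → Fin n → α) (i : Fin m)
    (r : Fin n) (d : α) :
    (List.ofFn fun i => List.ofFn fun r => F i r).flatten.getD (i * n + r) d = F i r := by
  have hlt : (i * n + r : ℕ) < m * n := by
    have : ((i : ℕ) + 1) * n ≤ m * n := Nat.mul_le_mul_right n i.2
    have h2 : ((i : ℕ) + 1) * n = i * n + n := by ring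
    have := r.2
    omega
  have hn : 0 < n := Fin.pos r
  rw [List.flatten_ofFn_ofFn, List.getD_eq_getElem _ _ (by simpa using hlt), List.getElem_ofFn]
  congr 1
  · ext
    simp [Fin.divNat, mul_comm (i : ℕ) n, Nat.mul_add_div hn]
  · ext
    simp [Fin.modNat, Nat.mod_eq_of_lt]

namespace SMInstance

variable {n : ℕ}

/-- The preference lists of the men, followed by those of the women. -/
def listing (I : SMInstance n) : List ℕ :=
  (List.ofFn fun i => List.ofFn fun r => (I.men i r : ℕ)).flatten ++
    (List.ofFn fun j => List.ofFn fun r => (I.women j r : ℕ)).flatten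

lemma length_listing (I : SMInstance n) : I.listing.length = n * n + n * n := by
  rw [listing, List.length_append, List.length_flatten_ofFn_ofFn, List.length_flatten_ofFn_ofFn]

lemma getD_listing_men (I : SMInstance n) (i r : Fin n) :
    I.listing.getD (i * n + r) 0 = I.men i r := by
  have hlt : (i * n + r : ℕ) < n * n := by
    have : ((i : ℕ) + 1) * n ≤ n * n := Nat.mul_le_mul_right n i.2
    have h2 : ((i : ℕ) + 1) * n = i * n + n := by ring
    have := r.2
    omega
  rw [listing, List.getD_append _ _ _ _ (by rwa [List.length_flatten_ofFn_ofFn])]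
  exact List.getD_flatten_ofFn_ofFn (fun i r => (I.men i r : ℕ)) i r 0

lemma getD_listing_women (I : SMInstance n) (j r : Fin n) :
    I.listing.getD (n * n + (j * n + r)) 0 = I.women j r := by
  rw [listing, List.getD_append_right _ _ _ _ (by rw [List.length_flatten_ofFn_ofFn]; omega),
    List.length_flatten_ofFn_ofFn, Nat.add_sub_cancel_left]
  exact List.getD_flatten_ofFn_ofFn (fun j r => (I.women j r : ℕ)) j r 0

/-- The list `π` enumerates people by their rank under `π.symm`, so scanning its first `m` entries
counts the top `m`. -/
lemma count_eq_topCount (π : Equiv.Perm (Fin n)) (e : Fin n → Bool) (P : ℕ → Prop)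
    [DecidablePred P] (hP : ∀ k : Fin n, P k ↔ e (π k) = true) {m : ℕ} (hm : m ≤ n) :
    Nat.count P m = topCount π.symm e m := by
  rw [Nat.count_eq_card_filter_range, topCount]
  refine (Finset.card_bij (fun h _ => (π.symm h : ℕ)) ?_ ?_ ?_).symm
  · intro h hh
    simp only [Finset.mem_filter, Finset.mem_univ, true_and, Finset.mem_range] at hh ⊢
    exact ⟨hh.2, by rw [hP, π.apply_symm_apply]; exact hh.1⟩
  · intro h _ h' _ heq
    exact π.symm.injective (Fin.ext heq)
  · intro k hk
    simp only [Finset.mem_filter, Finset.mem_range] at hk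
    have hkn : k < n := by omega
    refine ⟨π ⟨k, hkn⟩, ?_, by simp⟩
    simp only [Finset.mem_filter, Finset.mem_univ, true_and, π.symm_apply_apply]
    exact ⟨(hP ⟨k, hkn⟩).1 hk.2, hk.1⟩

lemma topCount_self (σ : Equiv.Perm (Fin n)) (e : Fin n → Bool) : topCount σ e n = posCount e := by
  simp [topCount, posCount]

lemma countMen_listing {n : ℕ} (I : SMInstance (n + 1)) {m : ℕ} (hm : m ≤ n + 1) :
    RAM.countMen (n + 1) (fun i => I.listing.getD i 0) m =
      topCount (I.women 0).symm (sameFirst I.men) m := by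
  refine count_eq_topCount _ _ _ (fun k => ?_) hm
  have h1 := I.getD_listing_women 0 k
  have h2 := I.getD_listing_men (I.women 0 k) 0
  have h3 := I.getD_listing_men 0 0
  simp only [Fin.val_zero, zero_mul, zero_add, add_zero] at h1 h2 h3
  beta_reduce
  rw [h1, h2, h3, sameFirst, decide_eq_true_iff, Fin.val_inj]

lemma countWomen_listing {n : ℕ} (I : SMInstance (n + 1)) {m : ℕ} (hm : m ≤ n + 1) :
    RAM.countWomen (n + 1) (fun i => I.listing.getD i 0) m =
      topCount (I.men 0).symm (sameFirst I.women) m := by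
  refine count_eq_topCount _ _ _ (fun k => ?_) hm
  have h1 := I.getD_listing_men 0 k
  have h2 := I.getD_listing_women (I.men 0 k) 0
  have h3 := I.getD_listing_women 0 0
  simp only [Fin.val_zero, zero_mul, zero_add, add_zero] at h1 h2 h3
  beta_reduce
  rw [h1, add_mul, h2, h3, sameFirst, decide_eq_true_iff, Fin.val_inj]

/-- The program computes the number of stable matchings. -/
theorem IsAttribute.outputs {I : SMInstance n} (h : I.IsAttribute 1) :
    RAM.Outputs (RAM.assemble 0 RAM.stableCounter) I.encode I.numStable
      (100 * (n * n + n * n + 1) + 100) := by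
  have hbounds : ∀ k < n, I.listing.getD k 0 < n ∧ I.listing.getD (n * n + k) 0 < n := by
    intro k hk
    have h1 := I.getD_listing_men ⟨0, by omega⟩ ⟨k, hk⟩
    have h2 := I.getD_listing_women ⟨0, by omega⟩ ⟨k, hk⟩
    simp only [zero_mul, zero_add] at h1 h2
    rw [h1, h2]
    exact ⟨Fin.isLt _, Fin.isLt _⟩
  have hrun := (RAM.terminates_stableCounter (D := I.listing) (fun i => rfl) hbounds).outputs
  rw [show I.encode = n :: I.listing from rfl]
  convert hrun using 1
  cases n with
  | zero =>
    obtain ⟨N, hN, hnum, -⟩ := (aligned_of_zero I).numStable_and_equiv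
    rw [hnum, hN]
    simp [topCount, RAM.countMen, RAM.countWomen]
  | succ n =>
    obtain ⟨N, hN, hnum, -⟩ := h.aligned.numStable_and_equiv
    rw [I.countMen_listing le_rfl, I.countWomen_listing le_rfl, topCount_self, topCount_self,
      I.countMen_listing (posCount_le _), I.countWomen_listing (posCount_le _)]
    omega

end SMInstance

lemma RAM.length_le_inputLength (x : List ℕ) : x.length ≤ RAM.inputLength x := by
  induction x with
  | nil => simp
  | cons a x ih =>
    simp only [RAM.inputLength, List.map_cons, List.sum_cons, List.length_cons] at ih ⊢
    omega

theorem theorem2 :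
    RAM.PolyTime (fun I : AttributeInstance 1 => I.2.1.encode)
      (fun I : AttributeInstance 1 => I.2.1.numStable) ∧
    ∀ (n : ℕ) (I : SMInstance n), I.IsAttribute 1 →
      (∃ k : ℕ, Nonempty (I.Precedes ≃r ((· < ·) : Fin k → Fin k → Prop))) ∧
      I.numStable = Nat.card I.RotationDownset ∧
      I.numStable = Nat.card I.Rotation + 1 := by
  refine ⟨⟨RAM.assemble 0 RAM.stableCounter, 100 * Polynomial.X + 100, ?_⟩,
    fun n I h => h.rotation_poset⟩
  rintro ⟨n, I, hI⟩
  obtain ⟨t, ht, hout⟩ := hI.outputs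
  -- Every entry of the encoding adds at least its separator to the length, so the time bound is
  -- linear in the input length.
  have hlen : n * n + n * n + 1 ≤ RAM.inputLength I.encode := by
    rw [← I.length_listing]
    exact RAM.length_le_inputLength (n :: I.listing)
  refine ⟨t, ht.trans ?_, hout⟩
  simp only [Polynomial.eval_add, Polynomial.eval_mul, Polynomial.eval_X, Polynomial.eval_ofNat]
  omega
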